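/- **Setting.** Let $f=\frac1n\sum_{i=1}^n f^i$ on $\mathbb R^d$ (Euclidean norm). Each $f^i$ is twice continuously differentiable, $\mu$-strongly convex and $L$-smooth ($\|\nabla f^i(x)-\nabla f^i(y)\|\le L\|x-y\|$), with $L,\mu>0$, and there are $\eta>0$, $\gamma\ge 0$ with $$\frac1n\sum_{i=1}^n\|\nabla f^i(x)\|^2\le \gamma^2+\eta\|\nabla f(x)\|^2\qquad\text{for all }x.$$ Let $x^*$ be the minimizer of $f$. In iteration $k=0,1,2,\dots$ a mini-batch $B_k$ is drawn, independently of the others and uniformly among the subsets of $\{1,\dots,n\}$ of size $b$ ($1\le b\le n$); put $g_{B}(x)=\frac1{|B|}\sum_{i\in B}\nabla f^i(x)$. **FUSE-PV.** Given a switchover iteration $K_1$, the method runs Adam for $k<K_1$: $$m_{k+1}=\beta_1m_k+(1-\beta_1)g_k,\quad v_{k+1}=\beta_2v_k+(1-\beta_2)\,g_k\odot g_k,\quad x_{k+1}=x_k-\alpha_k\tfrac{\sqrt{1-\beta_2^{k+1}}}{1-\beta_1^{k+1}}\,m_{k+1}\oslash\sqrt{v_{k+1}+a},$$ where $g_k=g_{B_k}(x_k)$,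 $\odot$ and $\oslash$ are the coordinatewise product and quotient, and $a>0$. For $k\ge K_1$ it runs stochastic L-BFGS with a constant step size $\tau$: $x_{k+1}=x_k+\tau p_k$, where $p_k$ is the output of the L-BFGS two-loop recursion (history size at least $1$, empty history at the switchover, middle scaling $\langle s,y\rangle/\langle y,y\rangle$ for the most recent stored pair and $1$ if there is none) applied to $g_{B_k}(x_k)$ and the stored pairs $s_k=x_{k+1}-x_k$, $y_k=g_{B_k}(x_{k+1})-g_{B_k}(x_k)$, a pair with $\langle s_k,y_k\rangle\le 0$ being discarded. The switchover takes place at the first iteration at which $\mathbb E\|\nabla f(x_k)\|^2\le\zeta$. **Theorem.** Fix $a>0$, $\beta_1\in(0,1)$, the history size, a number $\bar\zeta\in(0,1)$, and bounds $f(x_0)-f(x^*)\le\Delta$, $\|m_0\|\le M$, $0\le (v_0)_j\le V$ on the initialization. There are $\tau_0,c,N>0$ with $c\tau_0<1$, depending only on these numbers and on $L,\mu,\gamma,\eta$, such that for every $\tau\in(0,\tau_0]$ there is a constant $C>0$, depending only on $\tau$ and the same numbers (in particular not on $d$, $n$, $b$), with the following property. For all $d,n,b$ and $\zeta\in(0,\bar\zeta]$,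 for every $\beta_2<1$ that is sufficiently close to $1$ and a suitable choice of Adam step sizes $\alpha_k>0$ (depending on $\zeta$, $\beta_2$, $\tau$, $d,n,b$ and the numbers above, but not otherwise on the $f^i$ or on $x_0,m_0,v_0$), the iterates of FUSE-PV satisfy, for all such $f^i,x_0,m_0,v_0$: 1. (Adam phase) the switchover takes place at an iteration $K_1\le C/\zeta$; 2. (L-BFGS phase, linear convergence to a neighbourhood of $x^*$) for all $k\ge0$, $$\mathbb E[f(x_{K_1+k})-f(x^*)]\le(1-c\tau)^k\,\mathbb E[f(x_{K_1})-f(x^*)]+N\tau\gamma^2,$$ $$\mathbb E\|x_{K_1+k}-x^*\|^2\le N(1-c\tau)^k\,\mathbb E\|x_{K_1}-x^*\|^2+N\tau\gamma^2;$$ 3. (complexity) for every $\epsilon\in(0,\zeta)$ there is $K_2\le C\log(1/\epsilon)$ such that $$K_1+K_2\le C\max\{1/\zeta,\ \log(1/\epsilon)\}\quad\text{and}\quad \mathbb E\|\nabla f(x_k)\|^2\le\epsilon+N\tau\gamma^2\ \text{ for all }k\ge K_1+K_2 .$$ That is, FUSE-PV has iteration complexity $O(\max\{1/\zeta,\log(1/\epsilon)\})$,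 the $O(1/\zeta)$ iterations being those of Adam and the $O(\log(1/\epsilon))$ iterations those of L-BFGS. -/

import Mathlib

open MeasureTheory ProbabilityTheory

noncomputable section

namespace FusePV

/-- `ℝ^d` with the Euclidean norm. -/
abbrev Vec (d : ℕ) : Type := EuclideanSpace ℝ (Fin d)

/-- The empirical risk `f = (1/n) ∑ᵢ fⁱ`. -/
def risk {n d : ℕ} (f : Fin n → Vec d → ℝ) (x : Vec d) : ℝ :=
  (1 / (n : ℝ)) * ∑ i, f i x

/-- The mini-batch gradient `(1/|S|) ∑_{i ∈ S} ∇fⁱ(x)`. -/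
def batchGrad {n d : ℕ} (f : Fin n → Vec d → ℝ) (S : Finset (Fin n)) (x : Vec d) : Vec d :=
  (1 / (S.card : ℝ)) • ∑ i ∈ S, gradient (f i) x

/-- The standing assumptions on the sample losses. -/
structure Assumptions {n d : ℕ} (L μ γ η : ℝ) (f : Fin n → Vec d → ℝ) : Prop where
  /-- every `fⁱ` is twice continuously differentiable -/
  contDiff : ∀ i, ContDiff ℝ 2 (f i)
  /-- every `fⁱ` is `L`-smooth -/
  smooth : ∀ i x y, ‖gradient (f i) x - gradient (f i) y‖ ≤ L * ‖x - y‖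
  /-- every `fⁱ` is `μ`-strongly convex -/
  strongConvex : ∀ i, StrongConvexOn Set.univ μ (f i)
  /-- the growth condition `E_i ‖∇fⁱ(x)‖² ≤ γ² + η ‖∇f(x)‖²`, with `i` uniform -/
  growth : ∀ x, (1 / (n : ℝ)) * ∑ i, ‖gradient (f i) x‖ ^ 2
    ≤ γ ^ 2 + η * ‖gradient (risk f) x‖ ^ 2

/-- `B 0, B 1, …` are independent, each uniform on the subsets of `{1, …, n}` of size `b`. -/
structure IsMinibatchSampling {Ω : Type*} [MeasurableSpace Ω] {n : ℕ} (P : Measure Ω) (b : ℕ)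
    (B : ℕ → Ω → Finset (Fin n)) : Prop where
  measurableSet : ∀ k S, MeasurableSet {ω | B k ω = S}
  indep : iIndepFun (m := fun _ => (⊤ : MeasurableSpace (Finset (Fin n)))) B P
  uniform : ∀ k S, S.card = b → P.real {ω | B k ω = S} = 1 / (n.choose b : ℝ)

/-- The user-defined parameters of the method. -/
structure Params where
  /-- decay rate of the first moment in Adam -/
  β₁ : ℝ
  /-- decay rate of the second moment in Adam -/
  β₂ : ℝ
  /-- the positive constant under the square root in Adam -/
  a : ℝ
  /-- step sizes of Adam -/
  α : ℕ → ℝ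
  /-- history size of L-BFGS -/
  mem : ℕ
  /-- constant step size of L-BFGS -/
  τ : ℝ

/-- The state of the method: the iterate, the two moments of Adam, and the stored pairs
`(sᵢ, yᵢ)` of L-BFGS, most recent first. -/
structure State (d : ℕ) where
  x : Vec d
  m : Vec d
  v : Vec d
  hist : List (Vec d × Vec d)

/-- One step of Adam with stochastic gradient `g`; `k = 0` is the first step. -/
def adamStep {d : ℕ} (p : Params) (k : ℕ) (g : Vec d) (st : State d) : State d :=
  let m' : Vec d := p.β₁ • st.m + (1 - p.β₁) • g
  let v' : Vec d := WithLp.toLp 2 fun j => p.β₂ * st.v j + (1 - p.β₂) * (g j * g j)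
  let x' : Vec d := WithLp.toLp 2 fun j =>
    st.x j - p.α k * (√(1 - p.β₂ ^ (k + 1)) / (1 - p.β₁ ^ (k + 1))) * (m' j / √(v' j + p.a))
  { x := x', m := m', v := v', hist := st.hist }

/-- The two-loop recursion. The descent into the list (most recent pair first) is the first loop,
the return from it (oldest pair first) is the second one; `δ` is the scaling in between. -/
def twoLoop {d : ℕ} (δ : ℝ) : List (Vec d × Vec d) → Vec d → Vec d
  | [], q => δ • q
  | (s, y) :: h, q =>
    let αi : ℝ := inner ℝ s q / inner ℝ s y
    let r : Vec d := twoLoop δ h (q - αi • y)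
    r + (αi - inner ℝ y r / inner ℝ s y) • s

/-- The scaling `⟨s, y⟩ / ⟨y, y⟩` by the most recent pair (`1` if there is none). -/
def scaling {d : ℕ} : List (Vec d × Vec d) → ℝ
  | [] => 1
  | (s, y) :: _ => inner ℝ s y / inner ℝ y y

/-- The L-BFGS direction. -/
def direction {d : ℕ} (hist : List (Vec d × Vec d)) (g : Vec d) : Vec d :=
  twoLoop (scaling hist) hist (-g)

open Classical in
/-- One step of stochastic L-BFGS with constant step size, where `G` is the gradient of the current
mini-batch. Both gradients in `y` use this mini-batch. A pair with `⟨s, y⟩ ≤ 0` is not stored. -/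
def lbfgsStep {d : ℕ} (p : Params) (G : Vec d → Vec d) (st : State d) : State d :=
  let x' : Vec d := st.x + p.τ • direction st.hist (G st.x)
  let s : Vec d := x' - st.x
  let y : Vec d := G x' - G st.x
  { x := x', m := st.m, v := st.v,
    hist := if 0 < inner ℝ s y then ((s, y) :: st.hist).take p.mem else st.hist }

/-- FUSE-PV along a sequence `S` of mini-batches: Adam in the iterations before the switchover
iteration `K₁`, L-BFGS from then on. -/
def run {n d : ℕ} (p : Params) (f : Fin n → Vec d → ℝ) (x₀ m₀ v₀ : Vec d) (K₁ : ℕ)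
    (S : ℕ → Finset (Fin n)) : ℕ → State d
  | 0 => { x := x₀, m := m₀, v := v₀, hist := [] }
  | k + 1 =>
    let st := run p f x₀ m₀ v₀ K₁ S k
    if k < K₁ then adamStep p k (batchGrad f (S k) st.x) st
    else lbfgsStep p (batchGrad f (S k)) st

/-- The `k`-th iterate of FUSE-PV. -/
def iterate {n d : ℕ} (p : Params) (f : Fin n → Vec d → ℝ) (x₀ m₀ v₀ : Vec d) (K₁ : ℕ)
    (S : ℕ → Finset (Fin n)) (k : ℕ) : Vec d :=
  (run p f x₀ m₀ v₀ K₁ S k).x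

end FusePV

end

/-! The state before iteration k is a function of the earlier batches only, hence independent of
B_k. So every expected one-step estimate reduces to a deterministic inequality averaged over a
uniformly drawn batch T, in which the batch gradient averages to ∇f and, by the growth condition,
its square to at most γ² + η‖∇f‖².

L-BFGS. Both gradients in y use one batch, so each stored pair inherits the curvature bounds of an
L-smooth μ-strongly convex function. Each of the at most `mem` pairs changes the spectral bounds of
the inverse Hessian approximation in a controlled way, so these bounds involve only L, μ and `mem`
(`exists_twoLoop_bounds`). The matrix used at step k is built from past batches, so it passes
through the average. The descent lemma and the Polyak–Łojasiewicz inequality then contract the mean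
suboptimality by 1 - cτ, up to an error of order τ²γ² (`exists_lbfgs_rate`).

Adam. The step sizes α_k cancel the bias correction and leave θ_k = A/(k + k₀). On a horizon K of
order 1/ζ all iterates stay in a bounded set, and β₂ is taken so near 1 that the second moments
hardly leave v₀. Adam is then heavy-ball momentum with the fixed preconditioner H = diag(1/√(v₀ +
a)), up to a relative error θ_k. At the shifted point z = x - β₁/(1 - β₁) θ_k H m the momentum
cancels to first order, and f(z) - f(x*) + κθ_k²‖m‖² is a Lyapunov function W with E W_{k+1} ≤ (1 -
lo·μ·θ_k) E W_k + O(θ_k²) (`heavyBall_drift`). This gives E W_k = O(1/k), and W bounds ‖∇f(x)‖². The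
bounds on the iterates may be exponential in K and depend on n, because they influence only how near
1 the parameter β₂ must be.

The two phases are joined by taking the first K₁ of accuracy ζ: before the switchover the iterates
do not depend on when it takes place. -/

noncomputable section

namespace FusePV

/-! ### Smooth strongly convex functions -/

section Convex

variable {E : Type*} [NormedAddCommGroup E] [InnerProductSpace ℝ E] [CompleteSpace E]

theorem hasDerivAt_comp_line {F : E → ℝ} (hF : Differentiable ℝ F) (x v : E) (t : ℝ) :
    HasDerivAt (fun t : ℝ => F (x + t • v)) (inner ℝ (gradient F (x + t • v)) v) t := by
  have h1 : HasDerivAt (fun t : ℝ => x + t • v) v t := by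
    simpa using ((hasDerivAt_id t).smul_const v).const_add x
  rw [inner_gradient_left]
  exact (hF (x + t • v)).hasFDerivAt.comp_hasDerivAt t h1

/-- First-order characterisation of strong convexity. -/
theorem _root_.StrongConvexOn.add_inner_gradient_le {F : E → ℝ} {μ : ℝ}
    (hc : StrongConvexOn Set.univ μ F) (hF : Differentiable ℝ F) (x y : E) :
    F x + inner ℝ (gradient F x) (y - x) + μ / 2 * ‖y - x‖ ^ 2 ≤ F y := by
  have hd := hasDerivAt_comp_line hF x (y - x) 0
  simp only [zero_smul, add_zero] at hd
  have hs := hd.tendsto_slope_zero_right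
  -- Dividing the strong convexity inequality on the segment by t bounds the secant slope by this
  -- function of t; then t ↓ 0.
  have hlim : Filter.Tendsto (fun t : ℝ => F y - F x - (1 - t) * (μ / 2 * ‖x - y‖ ^ 2))
      (nhdsWithin 0 (Set.Ioi 0)) (nhds (F y - F x - (1 - 0) * (μ / 2 * ‖x - y‖ ^ 2))) := by
    apply Filter.Tendsto.mono_left _ nhdsWithin_le_nhds
    exact Continuous.tendsto (by fun_prop) 0
  have hle := le_of_tendsto_of_tendsto hs hlim (by
    have h01 : Set.Ioo (0 : ℝ) 1 ∈ nhdsWithin (0 : ℝ) (Set.Ioi 0) :=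
      Ioo_mem_nhdsGT one_pos
    filter_upwards [h01] with t ht
    have h := hc.2 (Set.mem_univ x) (Set.mem_univ y) (sub_nonneg.2 ht.2.le) ht.1.le (by ring)
    have e : x + t • (y - x) = (1 - t) • x + t • y := by module
    simp only [zero_add, zero_smul, add_zero, smul_eq_mul] at h ⊢
    rw [e, inv_mul_le_iff₀ ht.1]
    nlinarith)
  rw [norm_sub_rev y x]
  linarith

/-- The descent lemma. -/
theorem le_add_inner_gradient {F : E → ℝ} {L : ℝ} (hF : Differentiable ℝ F)
    (hl : ∀ x y, ‖gradient F x - gradient F y‖ ≤ L * ‖x - y‖) (x y : E) :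
    F y ≤ F x + inner ℝ (gradient F x) (y - x) + L / 2 * ‖y - x‖ ^ 2 := by
  set v := y - x with hv
  -- The claim is φ 1 ≤ φ 0, and the Lipschitz gradient makes the derivative of φ nonpositive for t
  -- > 0.
  let φ : ℝ → ℝ := fun t => F (x + t • v) - t * inner ℝ (gradient F x) v - L / 2 * ‖v‖ ^ 2 * t ^ 2
  have hφ : ∀ t, HasDerivAt φ (inner ℝ (gradient F (x + t • v)) v - 1 * inner ℝ (gradient F x) v
      - L / 2 * ‖v‖ ^ 2 * (2 * t)) t := fun t => by
    have h := ((hasDerivAt_comp_line hF x v t).sub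
      ((hasDerivAt_id t).mul_const (inner ℝ (gradient F x) v))).sub
      ((hasDerivAt_pow 2 t).const_mul (L / 2 * ‖v‖ ^ 2))
    refine h.congr_deriv ?_
    simp
  have han : AntitoneOn φ (Set.Ici 0) := by
    apply antitoneOn_of_deriv_nonpos (convex_Ici 0)
      (fun t _ => (hφ t).continuousAt.continuousWithinAt)
      (fun t _ => (hφ t).differentiableAt.differentiableWithinAt)
    intro t ht
    rw [interior_Ici, Set.mem_Ioi] at ht
    rw [(hφ t).deriv]
    have h1 : inner ℝ (gradient F (x + t • v) - gradient F x) v ≤ L * (t * ‖v‖) * ‖v‖ := by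
      refine (real_inner_le_norm _ _).trans ?_
      gcongr
      refine (hl _ _).trans_eq ?_
      rw [add_sub_cancel_left, norm_smul, Real.norm_of_nonneg ht.le]
    rw [inner_sub_left] at h1
    nlinarith
  have h := han (Set.mem_Ici.2 le_rfl) (Set.mem_Ici.2 zero_le_one) zero_le_one
  simp only [φ, one_smul, zero_smul, add_zero, hv] at h
  rw [add_sub_cancel] at h
  rw [hv]
  linarith

/-- First-order bounds satisfied by an `L`-smooth `μ`-strongly convex function. -/
structure SmoothStronglyConvex (L μ : ℝ) (F : E → ℝ) : Prop where
  lower : ∀ x y, F x + inner ℝ (gradient F x) (y - x) + μ / 2 * ‖y - x‖ ^ 2 ≤ F y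
  upper : ∀ x y, F y ≤ F x + inner ℝ (gradient F x) (y - x) + L / 2 * ‖y - x‖ ^ 2
  lipschitz : ∀ x y, ‖gradient F x - gradient F y‖ ≤ L * ‖x - y‖

namespace SmoothStronglyConvex

variable {F : E → ℝ} {L μ : ℝ}

theorem inner_gradient_sub_ge (hF : SmoothStronglyConvex L μ F) (x y : E) :
    μ * ‖x - y‖ ^ 2 ≤ inner ℝ (x - y) (gradient F x - gradient F y) := by
  have h1 := hF.lower x y
  have h2 := hF.lower y x
  have e1 : inner ℝ (gradient F x) (y - x) = - inner ℝ (x - y) (gradient F x) := by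
    rw [real_inner_comm, ← inner_neg_left, neg_sub]
  rw [e1, norm_sub_rev y x] at h1
  rw [real_inner_comm] at h2
  rw [inner_sub_right]
  linarith

/-- Minimize the quadratic lower bound at x over all displacements; z need not be the minimizer. -/
theorem polyak_lojasiewicz (hF : SmoothStronglyConvex L μ F) (hμ : 0 < μ) (x z : E) :
    2 * μ * (F x - F z) ≤ ‖gradient F x‖ ^ 2 := by
  have h1 := hF.lower x z
  have h2 := neg_le_of_abs_le (abs_real_inner_le_norm (gradient F x) (z - x))
  nlinarith [sq_nonneg (‖gradient F x‖ - μ * ‖z - x‖)]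

/-- A gradient step of length 1/L lowers F by at least ‖∇F(x)‖²/(2L), but not below the minimum. -/
theorem norm_gradient_sq_le (hF : SmoothStronglyConvex L μ F) (hL : 0 < L) {z : E}
    (hz : ∀ x, F z ≤ F x) (x : E) :
    ‖gradient F x‖ ^ 2 ≤ 2 * L * (F x - F z) := by
  have h1 := hF.upper x (x - (1 / L) • gradient F x)
  have h2 := hz (x - (1 / L) • gradient F x)
  have e : x - (1 / L) • gradient F x - x = -((1 / L) • gradient F x) := by abel
  rw [e, inner_neg_right, norm_neg, inner_smul_right, norm_smul, real_inner_self_eq_norm_sq,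
    Real.norm_of_nonneg (by positivity)] at h1
  have h3 : ‖gradient F x‖ ^ 2 / (2 * L) ≤ F x - F z := by
    have : -(1 / L * ‖gradient F x‖ ^ 2) + L / 2 * (1 / L * ‖gradient F x‖) ^ 2
        = - (‖gradient F x‖ ^ 2 / (2 * L)) := by field_simp; ring
    linarith
  rwa [div_le_iff₀' (by positivity)] at h3

theorem gradient_eq_zero (hF : SmoothStronglyConvex L μ F) (hL : 0 < L) {z : E}
    (hz : ∀ x, F z ≤ F x) : gradient F z = 0 := by
  have h := hF.norm_gradient_sq_le hL hz z
  rw [sub_self, mul_zero] at h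
  exact norm_eq_zero.1 (pow_eq_zero_iff two_ne_zero |>.1 (le_antisymm h (sq_nonneg _)))

theorem sub_le_norm_sq (hF : SmoothStronglyConvex L μ F) (hL : 0 < L) {z : E}
    (hz : ∀ x, F z ≤ F x) (x : E) :
    F x - F z ≤ L / 2 * ‖x - z‖ ^ 2 := by
  have h := hF.upper z x
  rw [hF.gradient_eq_zero hL hz, inner_zero_left] at h
  linarith

theorem norm_sq_le_sub (hF : SmoothStronglyConvex L μ F) (hL : 0 < L) {z : E}
    (hz : ∀ x, F z ≤ F x) (x : E) :
    μ / 2 * ‖x - z‖ ^ 2 ≤ F x - F z := by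
  have h := hF.lower z x
  rw [hF.gradient_eq_zero hL hz, inner_zero_left] at h
  linarith

end SmoothStronglyConvex

end Convex

/-! ### The empirical risk and the batch gradients -/

variable {n d : ℕ} {L μ γ η : ℝ} {f : Fin n → Vec d → ℝ}

namespace Assumptions

theorem differentiable (hf : Assumptions L μ γ η f) (i : Fin n) : Differentiable ℝ (f i) :=
  (hf.contDiff i).differentiable (by norm_num)

theorem gradient_risk (hf : Assumptions L μ γ η f) (x : Vec d) :
    gradient (risk f) x = (1 / (n : ℝ)) • ∑ i, gradient (f i) x := by
  apply HasGradientAt.gradient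
  have h := (HasFDerivAt.fun_sum fun i (_ : i ∈ Finset.univ) =>
    (hf.differentiable i x).hasGradientAt.hasFDerivAt).const_mul (1 / (n : ℝ))
  rw [hasGradientAt_iff_hasFDerivAt]
  refine h.congr_fderiv ?_
  rw [map_smulₛₗ, map_sum]
  rfl

theorem smoothStronglyConvex_apply (hf : Assumptions L μ γ η f) (i : Fin n) :
    SmoothStronglyConvex L μ (f i) where
  lower := (hf.strongConvex i).add_inner_gradient_le (hf.differentiable i)
  upper := le_add_inner_gradient (hf.differentiable i) (hf.smooth i)
  lipschitz := hf.smooth i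

theorem smoothStronglyConvex (hf : Assumptions L μ γ η f) (hn : 0 < n) :
    SmoothStronglyConvex L μ (risk f) where
  lower x y := by
    have hn' : (0 : ℝ) < n := by exact_mod_cast hn
    have h := Finset.sum_le_sum fun i (_ : i ∈ Finset.univ) =>
      (hf.smoothStronglyConvex_apply i).lower x y
    simp only [Finset.sum_add_distrib, Finset.sum_const, Finset.card_univ, Fintype.card_fin,
      nsmul_eq_mul] at h
    have h2 := mul_le_mul_of_nonneg_left h (by positivity : 0 ≤ 1 / (n : ℝ))
    rw [hf.gradient_risk, inner_smul_left, sum_inner]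
    simp only [risk, conj_trivial]
    refine le_trans (le_of_eq ?_) h2
    field_simp
  upper x y := by
    have hn' : (0 : ℝ) < n := by exact_mod_cast hn
    have h := Finset.sum_le_sum fun i (_ : i ∈ Finset.univ) =>
      (hf.smoothStronglyConvex_apply i).upper x y
    simp only [Finset.sum_add_distrib, Finset.sum_const, Finset.card_univ, Fintype.card_fin,
      nsmul_eq_mul] at h
    have h2 := mul_le_mul_of_nonneg_left h (by positivity : 0 ≤ 1 / (n : ℝ))
    rw [hf.gradient_risk, inner_smul_left, sum_inner]
    simp only [risk, conj_trivial]
    refine h2.trans (le_of_eq ?_)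
    field_simp
  lipschitz x y := by
    have hn' : (0 : ℝ) < n := by exact_mod_cast hn
    rw [hf.gradient_risk, hf.gradient_risk, ← smul_sub, ← Finset.sum_sub_distrib, norm_smul,
      Real.norm_of_nonneg (by positivity), one_div, inv_mul_le_iff₀ hn']
    refine (norm_sum_le_of_le _ fun i _ => hf.smooth i x y).trans_eq ?_
    simp

theorem norm_batchGrad_sub_le (hf : Assumptions L μ γ η f) (hL : 0 ≤ L) (S : Finset (Fin n))
    (x y : Vec d) : ‖batchGrad f S x - batchGrad f S y‖ ≤ L * ‖x - y‖ := by
  rcases S.eq_empty_or_nonempty with rfl | hS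
  · simpa [batchGrad] using by positivity
  have hc : (0 : ℝ) < S.card := by exact_mod_cast hS.card_pos
  rw [batchGrad, batchGrad, ← smul_sub, ← Finset.sum_sub_distrib, norm_smul,
      Real.norm_of_nonneg (by positivity), one_div, inv_mul_le_iff₀ hc]
  refine (norm_sum_le_of_le _ fun i _ => hf.smooth i x y).trans_eq ?_
  simp

theorem inner_batchGrad_sub_ge (hf : Assumptions L μ γ η f) {S : Finset (Fin n)}
    (hS : S.Nonempty) (x y : Vec d) :
    μ * ‖x - y‖ ^ 2 ≤ inner ℝ (x - y) (batchGrad f S x - batchGrad f S y) := by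
  have hc : (0 : ℝ) < S.card := by exact_mod_cast hS.card_pos
  rw [batchGrad, batchGrad, ← smul_sub, ← Finset.sum_sub_distrib, inner_smul_right, one_div,
    le_inv_mul_iff₀ hc, inner_sum]
  refine le_trans (le_of_eq ?_) (Finset.sum_le_sum fun i (_ : i ∈ S) =>
    (hf.smoothStronglyConvex_apply i).inner_gradient_sub_ge x y)
  simp

theorem norm_batchGrad_sq_le (S : Finset (Fin n)) (x : Vec d) :
    ‖batchGrad f S x‖ ^ 2 ≤ (1 / (S.card : ℝ)) * ∑ i ∈ S, ‖gradient (f i) x‖ ^ 2 := by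
  rcases S.eq_empty_or_nonempty with rfl | hS
  · simp [batchGrad]
  have hc : (0 : ℝ) < S.card := by exact_mod_cast hS.card_pos
  rw [batchGrad, norm_smul, Real.norm_of_nonneg (by positivity), mul_pow]
  have h1 : ‖∑ i ∈ S, gradient (f i) x‖ ^ 2 ≤ (∑ i ∈ S, ‖gradient (f i) x‖) ^ 2 := by
    gcongr; exact norm_sum_le _ _
  have h2 := h1.trans (sq_sum_le_card_mul_sum_sq (s := S) (f := fun i => ‖gradient (f i) x‖))
  calc _ ≤ (1 / (S.card : ℝ)) ^ 2 * (S.card * ∑ i ∈ S, ‖gradient (f i) x‖ ^ 2) := by gcongr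
    _ = _ := by field_simp

end Assumptions

/-- The average over the subsets of `{1, …, n}` of size `b`. -/
def batchAvg {n : ℕ} (b : ℕ) (φ : Finset (Fin n) → ℝ) : ℝ :=
  (1 / (n.choose b : ℝ)) * ∑ T ∈ Finset.powersetCard b Finset.univ, φ T

/-! ### Averages over a uniform batch -/

section BatchAvg

variable {n b : ℕ}

theorem batchAvg_mono {φ ψ : Finset (Fin n) → ℝ} (h : ∀ T, φ T ≤ ψ T) :
    batchAvg b φ ≤ batchAvg b ψ :=
  mul_le_mul_of_nonneg_left (Finset.sum_le_sum fun T _ => h T) (by positivity)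

theorem batchAvg_const (hbn : b ≤ n) (c : ℝ) : batchAvg b (fun _ : Finset (Fin n) => c) = c := by
  have h : ((n.choose b : ℕ) : ℝ) ≠ 0 := by exact_mod_cast (Nat.choose_pos hbn).ne'
  simp only [batchAvg, Finset.sum_const, Finset.card_powersetCard, Finset.card_univ,
    Fintype.card_fin, nsmul_eq_mul]
  field_simp

theorem batchAvg_add (φ ψ : Finset (Fin n) → ℝ) :
    batchAvg b (fun T => φ T + ψ T) = batchAvg b φ + batchAvg b ψ := by
  simp only [batchAvg, Finset.sum_add_distrib, mul_add]

theorem batchAvg_const_mul (c : ℝ) (φ : Finset (Fin n) → ℝ) :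
    batchAvg b (fun T => c * φ T) = c * batchAvg b φ := by
  simp only [batchAvg, ← Finset.mul_sum]
  ring

theorem card_filter_mem_powersetCard (hb : 1 ≤ b) (i : Fin n) :
    ((Finset.powersetCard b (Finset.univ : Finset (Fin n))).filter (i ∈ ·)).card
      = (n - 1).choose (b - 1) := by
  simpa using Finset.card_filter_powersetCard_subset {i} Finset.univ b (by simp) (by simpa using hb)

/-- Double counting: each index lies in C(n-1, b-1) batches, and n·C(n-1, b-1) = b·C(n, b). -/
theorem batchAvg_mean (hb : 1 ≤ b) (hbn : b ≤ n) (u : Fin n → ℝ) :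
    batchAvg b (fun T => (1 / (T.card : ℝ)) * ∑ i ∈ T, u i) = (1 / (n : ℝ)) * ∑ i, u i := by
  obtain ⟨c, rfl⟩ : ∃ c, b = c + 1 := ⟨b - 1, by omega⟩
  obtain ⟨m, rfl⟩ : ∃ m, n = m + 1 := ⟨n - 1, by omega⟩
  have h1 : ∑ T ∈ Finset.powersetCard (c + 1) (Finset.univ : Finset (Fin (m + 1))),
      (1 / (T.card : ℝ)) * ∑ i ∈ T, u i
      = (1 / ((c + 1 : ℕ) : ℝ)) * ∑ T ∈ Finset.powersetCard (c + 1) Finset.univ,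
        ∑ i, if i ∈ T then u i else 0 := by
    rw [Finset.mul_sum]
    refine Finset.sum_congr rfl fun T hT => ?_
    rw [(Finset.mem_powersetCard.1 hT).2, Finset.sum_ite_mem, Finset.univ_inter]
  have h2 : ∀ i : Fin (m + 1), ∑ T ∈ Finset.powersetCard (c + 1) Finset.univ,
      (if i ∈ T then u i else 0) = (m.choose c : ℝ) * u i := fun i => by
    rw [← Finset.sum_filter, Finset.sum_const, card_filter_mem_powersetCard hb, nsmul_eq_mul]
    simp
  rw [batchAvg, h1, Finset.sum_comm]
  simp only [h2]
  rw [← Finset.mul_sum]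
  have h3 : ((m + 1 : ℕ) : ℝ) * (m.choose c : ℝ)
      = ((m + 1).choose (c + 1) : ℝ) * ((c + 1 : ℕ) : ℝ) := by
    exact_mod_cast Nat.add_one_mul_choose_eq m c
  have h4 : ((m + 1).choose (c + 1) : ℝ) ≠ 0 := by exact_mod_cast (Nat.choose_pos hbn).ne'
  have h5 : ((c + 1 : ℕ) : ℝ) ≠ 0 := by positivity
  have h6 : ((m + 1 : ℕ) : ℝ) ≠ 0 := by positivity
  field_simp
  linear_combination (∑ i, u i) * h3

variable {d : ℕ} {L μ γ η : ℝ} {f : Fin n → Vec d → ℝ}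

theorem Assumptions.batchAvg_inner_batchGrad (hf : Assumptions L μ γ η f) (hb : 1 ≤ b)
    (hbn : b ≤ n) (w x : Vec d) :
    batchAvg b (fun T => inner ℝ w (batchGrad f T x)) = inner ℝ w (gradient (risk f) x) := by
  simp only [batchGrad, hf.gradient_risk, inner_smul_right, inner_sum]
  exact batchAvg_mean hb hbn _

theorem Assumptions.batchAvg_norm_batchGrad_sq_le (hf : Assumptions L μ γ η f) (hb : 1 ≤ b)
    (hbn : b ≤ n) (x : Vec d) :
    batchAvg b (fun T => ‖batchGrad f T x‖ ^ 2) ≤ γ ^ 2 + η * ‖gradient (risk f) x‖ ^ 2 := by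
  refine (batchAvg_mono fun T => Assumptions.norm_batchGrad_sq_le T x).trans ?_
  rw [batchAvg_mean hb hbn]
  exact hf.growth x

/-- Both phases produce one-step bounds of this shape, a constant plus a linear and a squared-norm
term in the batch gradient; here unbiasedness and the growth condition enter. -/
theorem Assumptions.batchAvg_le (hf : Assumptions L μ γ η f) (hb : 1 ≤ b) (hbn : b ≤ n)
    {φ : Finset (Fin n) → ℝ} {x w : Vec d} {a c : ℝ} (hc : 0 ≤ c)
    (h : ∀ T, φ T ≤ a + inner ℝ w (batchGrad f T x) + c * ‖batchGrad f T x‖ ^ 2) :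
    batchAvg b φ ≤ a + inner ℝ w (gradient (risk f) x)
      + c * (γ ^ 2 + η * ‖gradient (risk f) x‖ ^ 2) := by
  refine (batchAvg_mono h).trans ?_
  rw [batchAvg_add, batchAvg_add, batchAvg_const hbn, batchAvg_const_mul,
    hf.batchAvg_inner_batchGrad hb hbn]
  have := mul_le_mul_of_nonneg_left (hf.batchAvg_norm_batchGrad_sq_le hb hbn x) hc
  linarith

end BatchAvg

/-! ### Conditioning on the past batches -/

section Sampling

variable {n b : ℕ} {Ω : Type*} [MeasurableSpace Ω] {P : Measure Ω}
  {B : ℕ → Ω → Finset (Fin n)}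

namespace IsMinibatchSampling

theorem measurable_batch (hB : IsMinibatchSampling P b B) (k : ℕ) :
    Measurable[_, ⊤] (B k) := by
  let _ : MeasurableSpace (Finset (Fin n)) := ⊤
  exact measurable_to_countable' fun S => hB.measurableSet k S

variable [IsProbabilityMeasure P]

/-- The factor lives on a finite type, where measurability and integrability are automatic. -/
theorem exists_comp_restrict {k : ℕ} {Ψ : (ℕ → Finset (Fin n)) → ℝ}
    (hΨ : DependsOn Ψ (Set.Iio k)) :
    ∃ Ψ' : (Finset.range k → Finset (Fin n)) → ℝ, ∀ S, Ψ S = Ψ' fun i => S i := by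
  refine ⟨fun s => Ψ fun j => if h : j ∈ Finset.range k then s ⟨j, h⟩ else ∅, fun S => hΨ ?_⟩
  intro i hi
  simp [Set.mem_Iio.1 hi]

theorem integrable (hB : IsMinibatchSampling P b B) {k : ℕ} {Ψ : (ℕ → Finset (Fin n)) → ℝ}
    (hΨ : DependsOn Ψ (Set.Iio k)) : Integrable (fun ω => Ψ fun j => B j ω) P := by
  let _ : MeasurableSpace (Finset (Fin n)) := ⊤
  obtain ⟨Ψ', h⟩ := exists_comp_restrict hΨ
  simp only [h]
  have hm : Measurable fun ω => fun i : Finset.range k => B i ω :=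
    measurable_pi_lambda _ fun i => hB.measurable_batch i
  have := Measure.isProbabilityMeasure_map (μ := P) hm.aemeasurable
  exact (Integrable.of_finite (μ := P.map fun ω => fun i : Finset.range k => B i ω)
    (f := Ψ')).comp_measurable hm

/-- The sets of size b already carry total mass 1, so all others are null. -/
theorem real_eq_ite (hB : IsMinibatchSampling P b B) (hbn : b ≤ n) (k : ℕ) (T : Finset (Fin n)) :
    P.real {ω | B k ω = T} = if T.card = b then 1 / (n.choose b : ℝ) else 0 := by
  split_ifs with hT
  · exact hB.uniform k T hT
  let _ : MeasurableSpace (Finset (Fin n)) := ⊤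
  have h1 := sum_measureReal_preimage_singleton (μ := P) (Finset.univ : Finset (Finset (Fin n)))
    (f := B k) (fun y _ => hB.measurableSet k y)
  simp only [Finset.coe_univ, Set.preimage_univ, probReal_univ] at h1
  have h2 : ∑ y ∈ Finset.powersetCard b (Finset.univ : Finset (Fin n)),
      P.real (B k ⁻¹' {y}) = 1 := by
    rw [Finset.sum_congr rfl fun y hy => show P.real (B k ⁻¹' {y}) = _ from
      hB.uniform k y (Finset.mem_powersetCard.1 hy).2]
    have h : ((n.choose b : ℕ) : ℝ) ≠ 0 := by exact_mod_cast (Nat.choose_pos hbn).ne'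
    simp [h]
  have h3 := Finset.sum_sdiff (f := fun y => P.real (B k ⁻¹' {y}))
    (Finset.subset_univ (Finset.powersetCard b (Finset.univ : Finset (Fin n))))
  rw [h1, h2] at h3
  have h4 := (Finset.sum_eq_zero_iff_of_nonneg (fun _ _ => measureReal_nonneg)).1
    (by linarith : _ = (0 : ℝ)) T (by simp [hT])
  exact h4

/-- The tower property without conditional expectations: integrating out B_k, which is independent
of the earlier batches, means overwriting coordinate k by T and averaging over T. -/
theorem integral_eq_integral_batchAvg (hB : IsMinibatchSampling P b B) (hbn : b ≤ n) {k : ℕ}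
    {Ψ : (ℕ → Finset (Fin n)) → ℝ} (hΨ : DependsOn Ψ (Set.Iio (k + 1))) :
    ∫ ω, Ψ (fun j => B j ω) ∂P
      = ∫ ω, batchAvg b (fun T => Ψ (Function.update (fun j => B j ω) k T)) ∂P := by
  let _ : MeasurableSpace (Finset (Fin n)) := ⊤
  have hdep : ∀ T, DependsOn (fun S => Ψ (Function.update S k T)) (Set.Iio k) := by
    intro T x y hxy
    refine hΨ fun i hi => ?_
    rcases eq_or_ne i k with rfl | hik
    · simp
    · simpa [hik] using hxy i (lt_of_le_of_ne (Nat.lt_succ_iff.1 hi) hik)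
  -- Split by the value of B_k; with that value frozen, the second factor depends on the past only.
  have hsplit : ∀ ω, Ψ (fun j => B j ω) = ∑ T : Finset (Fin n),
      (if B k ω = T then 1 else 0) * Ψ (Function.update (fun j => B j ω) k T) := by
    intro ω
    simp only [ite_mul, one_mul, zero_mul, Finset.sum_ite_eq, Finset.mem_univ, if_true]
    congr 1
    exact (Function.update_eq_self k fun j => B j ω).symm
  have hind : ∀ T : Finset (Fin n), Integrable (fun ω => (if B k ω = T then (1 : ℝ) else 0)) P := by
    intro T
    exact hB.integrable (k := k + 1) (Ψ := fun S => if S k = T then (1 : ℝ) else 0)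
      fun x y hxy => by simp [hxy k (Set.mem_Iio.2 k.lt_succ_self)]
  have hprod : ∀ T : Finset (Fin n), Integrable (fun ω => (if B k ω = T then (1 : ℝ) else 0) *
      Ψ (Function.update (fun j => B j ω) k T)) P := by
    intro T
    refine hB.integrable (k := k + 1)
      (Ψ := fun S => (if S k = T then (1 : ℝ) else 0) * Ψ (Function.update S k T)) ?_
    intro x y hxy
    have := hdep T (x := x) (y := y) fun i hi => hxy i (lt_trans hi k.lt_succ_self)
    simp only at this
    simp only [hxy k (Set.mem_Iio.2 k.lt_succ_self), this]
  have hterm : ∀ T : Finset (Fin n), ∫ ω, (if B k ω = T then (1 : ℝ) else 0) *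
      Ψ (Function.update (fun j => B j ω) k T) ∂P
      = P.real {ω | B k ω = T} * ∫ ω, Ψ (Function.update (fun j => B j ω) k T) ∂P := by
    intro T
    obtain ⟨Ψ', h⟩ := exists_comp_restrict (hdep T)
    have hi := hB.indep.indepFun_finset {k} (Finset.range k) (by simp) hB.measurable_batch
    have hI := hi.integral_fun_comp_mul_comp
      (f := fun s : ({k} : Finset ℕ) → Finset (Fin n) =>
        if s ⟨k, Finset.mem_singleton_self k⟩ = T then (1 : ℝ) else 0) (g := Ψ')
      (measurable_pi_lambda (fun ω (i : ({k} : Finset ℕ)) => B i ω)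
        fun i => hB.measurable_batch i).aemeasurable
      (measurable_pi_lambda (fun ω (i : Finset.range k) => B i ω)
        fun i => hB.measurable_batch i).aemeasurable
      (Measurable.of_discrete.aestronglyMeasurable) (Measurable.of_discrete.aestronglyMeasurable)
    simp only [h]
    rw [hI]
    congr 1
    have : (fun ω => if B k ω = T then (1 : ℝ) else 0) = Set.indicator {ω | B k ω = T} 1 := by
      ext ω; simp [Set.indicator_apply]
    rw [this, integral_indicator_one (hB.measurableSet k T)]
  calc ∫ ω, Ψ (fun j => B j ω) ∂P
      = ∑ T : Finset (Fin n), P.real {ω | B k ω = T} *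
          ∫ ω, Ψ (Function.update (fun j => B j ω) k T) ∂P := by
        simp only [hsplit]
        rw [integral_finsetSum _ fun T _ => hprod T]
        exact Finset.sum_congr rfl fun T _ => hterm T
    _ = _ := by
        simp only [batchAvg]
        rw [integral_const_mul, integral_finsetSum _ fun T _ => hB.integrable (hdep T)]
        simp only [hB.real_eq_ite hbn, ite_mul, zero_mul]
        rw [← Finset.sum_filter, Finset.mul_sum]
        refine Finset.sum_congr ?_ fun _ _ => rfl
        ext T; simp

theorem integral_le_of_batchAvg_le (hB : IsMinibatchSampling P b B) (hbn : b ≤ n) {k : ℕ}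
    {Ψ Φ : (ℕ → Finset (Fin n)) → ℝ} (hΨ : DependsOn Ψ (Set.Iio (k + 1)))
    (hΦ : DependsOn Φ (Set.Iio k))
    (h : ∀ S, batchAvg b (fun T => Ψ (Function.update S k T)) ≤ Φ S) :
    ∫ ω, Ψ (fun j => B j ω) ∂P ≤ ∫ ω, Φ (fun j => B j ω) ∂P := by
  rw [hB.integral_eq_integral_batchAvg hbn hΨ]
  refine integral_mono (hB.integrable (k := k)
    (Ψ := fun S => batchAvg b fun T => Ψ (Function.update S k T)) ?_) (hB.integrable hΦ)
    fun ω => h _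
  intro x y hxy
  simp only [batchAvg]
  congr 1
  refine Finset.sum_congr rfl fun T _ => hΨ fun i hi => ?_
  rcases eq_or_ne i k with rfl | hik
  · simp
  · simpa [hik] using hxy i (lt_of_le_of_ne (Nat.lt_succ_iff.1 hi) hik)

end IsMinibatchSampling

end Sampling

/-! ### Spectral bounds for the two-loop recursion -/

section TwoLoop

/-- A pair `(s, y)` with positive curvature satisfying the bounds of an `L`-smooth `μ`-strongly
convex function. -/
structure CurvaturePair {d : ℕ} (L μ : ℝ) (p : Vec d × Vec d) : Prop where
  pos : 0 < inner ℝ p.1 p.2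
  ge : μ * ‖p.1‖ ^ 2 ≤ inner ℝ p.1 p.2
  norm_le : ‖p.2‖ ≤ L * ‖p.1‖

variable {d : ℕ}

theorem twoLoop_add (δ : ℝ) (h : List (Vec d × Vec d)) (q q' : Vec d) :
    twoLoop δ h (q + q') = twoLoop δ h q + twoLoop δ h q' := by
  induction h generalizing q q' with
  | nil => simp [twoLoop]
  | cons p h ih =>
    obtain ⟨s, y⟩ := p
    have e : q + q' - (inner ℝ s (q + q') / inner ℝ s y) • y
        = (q - (inner ℝ s q / inner ℝ s y) • y) + (q' - (inner ℝ s q' / inner ℝ s y) • y) := by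
      rw [inner_add_right, add_div]; module
    simp only [twoLoop]
    rw [e, ih, inner_add_right, inner_add_right]
    module

theorem twoLoop_smul (δ : ℝ) (h : List (Vec d × Vec d)) (c : ℝ) (q : Vec d) :
    twoLoop δ h (c • q) = c • twoLoop δ h q := by
  induction h generalizing q with
  | nil => exact smul_comm _ _ _
  | cons p h ih =>
    obtain ⟨s, y⟩ := p
    have e : c • q - (inner ℝ s (c • q) / inner ℝ s y) • y
        = c • (q - (inner ℝ s q / inner ℝ s y) • y) := by
      rw [inner_smul_right, mul_div_assoc]; module
    simp only [twoLoop]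
    rw [e, ih, inner_smul_right, inner_smul_right, mul_div_assoc, mul_div_assoc]
    module

/-- The two-loop recursion as a linear map. -/
def twoLoopLinear (δ : ℝ) (h : List (Vec d × Vec d)) : Vec d →ₗ[ℝ] Vec d where
  toFun := twoLoop δ h
  map_add' := twoLoop_add δ h
  map_smul' := twoLoop_smul δ h

theorem direction_eq_neg (h : List (Vec d × Vec d)) (g : Vec d) :
    direction h g = - twoLoopLinear (scaling h) h g := by
  rw [direction, ← map_neg]
  rfl

/-- The quadratic form of the BFGS update Vᵀ H V + s sᵀ/⟨s, y⟩ with V = I - y sᵀ/⟨s, y⟩. -/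
theorem inner_twoLoop_cons {δ : ℝ} {h : List (Vec d × Vec d)} {s y : Vec d}
    (hsy : (inner ℝ s y : ℝ) ≠ 0) (q : Vec d) :
    inner ℝ q (twoLoop δ ((s, y) :: h) q)
      = inner ℝ (q - (inner ℝ s q / inner ℝ s y) • y)
          (twoLoop δ h (q - (inner ℝ s q / inner ℝ s y) • y))
        + (inner ℝ s q / inner ℝ s y) ^ 2 * inner ℝ s y := by
  simp only [twoLoop]
  set r := twoLoop δ h (q - (inner ℝ s q / inner ℝ s y) • y)
  rw [inner_add_right, inner_smul_right, inner_sub_left, inner_smul_left, real_inner_comm q s]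
  simp only [conj_trivial]
  field_simp
  ring

/-- Since q = (q - ty) + ty, the two terms of the quadratic form control the two pieces of q;
weighted Cauchy–Schwarz adds the reciprocals 1/lo and L²/μ. In matrix terms, the Hessian
approximation grows by at most yyᵀ/⟨s, y⟩. -/
theorem le_inner_twoLoop_cons {L μ δ lo : ℝ} (hL : 0 < L) (hμ : 0 < μ) (hlo : 0 < lo)
    {h : List (Vec d × Vec d)} {p : Vec d × Vec d} (hp : CurvaturePair L μ p)
    (ih : ∀ q, lo * ‖q‖ ^ 2 ≤ inner ℝ q (twoLoop δ h q)) (q : Vec d) :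
    1 / (1 / lo + L ^ 2 / μ) * ‖q‖ ^ 2 ≤ inner ℝ q (twoLoop δ (p :: h) q) := by
  obtain ⟨s, y⟩ := p
  obtain ⟨h1, h2, h3⟩ := hp
  simp only at h1 h2 h3
  rw [inner_twoLoop_cons h1.ne']
  set t : ℝ := inner ℝ s q / inner ℝ s y
  have hy : ‖t • y‖ ^ 2 ≤ L ^ 2 / μ * (t ^ 2 * inner ℝ s y) := by
    rw [norm_smul, mul_pow, Real.norm_eq_abs, sq_abs]
    have : ‖y‖ ^ 2 ≤ L ^ 2 / μ * inner ℝ s y := by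
      rw [div_mul_eq_mul_div, le_div_iff₀ hμ]
      have : ‖y‖ ^ 2 ≤ (L * ‖s‖) ^ 2 := by gcongr
      nlinarith [sq_nonneg L]
    nlinarith [sq_nonneg t]
  have hq := ih (q - t • y)
  have hn : ‖q‖ ≤ ‖q - t • y‖ + ‖t • y‖ := by simpa using norm_add_le (q - t • y) (t • y)
  set A := ‖q - t • y‖
  set D := ‖t • y‖
  set Z : ℝ := t ^ 2 * inner ℝ s y
  have hc : 0 < L ^ 2 / μ := by positivity
  set c := L ^ 2 / μ
  have hZ : D ^ 2 / c ≤ Z := by rwa [div_le_iff₀' hc]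
  have key : 1 / (1 / lo + c) * ‖q‖ ^ 2 ≤ lo * A ^ 2 + D ^ 2 / c := by
    rw [one_div_mul_eq_div, div_le_iff₀ (by positivity)]
    have h5 : ‖q‖ ^ 2 ≤ (A + D) ^ 2 := by gcongr
    have h6 : (lo * A ^ 2 + D ^ 2 / c) * (1 / lo + c) = (A + D) ^ 2
        + (lo * c * A - D) ^ 2 / (lo * c) := by
      field_simp; ring
    have h7 : 0 ≤ (lo * c * A - D) ^ 2 / (lo * c) := by positivity
    linarith
  linarith

/-- The rank-one maps of the update have norm at most L/μ (mixed s and y) or 1/μ (s with s). -/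
theorem norm_twoLoop_cons_le {L μ δ hi : ℝ} (hL : 0 < L) (hμ : 0 < μ) (hhi : 0 < hi)
    {h : List (Vec d × Vec d)} {p : Vec d × Vec d} (hp : CurvaturePair L μ p)
    (ih : ∀ q, ‖twoLoop δ h q‖ ≤ hi * ‖q‖) (q : Vec d) :
    ‖twoLoop δ (p :: h) q‖ ≤ ((1 + L / μ) ^ 2 * hi + 1 / μ) * ‖q‖ := by
  obtain ⟨s, y⟩ := p
  obtain ⟨h1, h2, h3⟩ := hp
  simp only at h1 h2 h3
  simp only [twoLoop]
  have hsy : ‖s‖ * ‖y‖ ≤ L / μ * inner ℝ s y := by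
    rw [div_mul_eq_mul_div, le_div_iff₀ hμ]
    nlinarith [norm_nonneg s, mul_le_mul_of_nonneg_left h3 (norm_nonneg s)]
  have hss : ‖s‖ * ‖s‖ ≤ 1 / μ * inner ℝ s y := by
    rw [one_div_mul_eq_div, le_div_iff₀ hμ]; nlinarith
  have rank_one : ∀ (u v w : Vec d) (C : ℝ), ‖u‖ * ‖v‖ ≤ C * inner ℝ s y →
      ‖(inner ℝ u w / inner ℝ s y) • v‖ ≤ C * ‖w‖ := by
    intro u v w C hC
    rw [norm_smul, norm_div, Real.norm_of_nonneg h1.le, div_mul_eq_mul_div, div_le_iff₀ h1]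
    have := norm_inner_le_norm (𝕜 := ℝ) u w
    calc ‖(inner ℝ u w : ℝ)‖ * ‖v‖ ≤ (‖u‖ * ‖w‖) * ‖v‖ := by gcongr
      _ = (‖u‖ * ‖v‖) * ‖w‖ := by ring
      _ ≤ (C * inner ℝ s y) * ‖w‖ := by gcongr
      _ = _ := by ring
  set q' := q - (inner ℝ s q / inner ℝ s y) • y
  set r := twoLoop δ h q'
  have hq' : ‖q'‖ ≤ (1 + L / μ) * ‖q‖ := by
    refine (norm_sub_le _ _).trans ?_
    have := rank_one s y q _ hsy
    linarith
  have hr : ‖r‖ ≤ hi * ((1 + L / μ) * ‖q‖) := (ih q').trans (by gcongr)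
  have e : r + (inner ℝ s q / inner ℝ s y - inner ℝ y r / inner ℝ s y) • s
      = r + (inner ℝ s q / inner ℝ s y) • s - (inner ℝ y r / inner ℝ s y) • s := by module
  rw [e]
  refine (norm_sub_le _ _).trans ?_
  have a1 := norm_add_le r ((inner ℝ s q / inner ℝ s y) • s)
  have a2 := rank_one s s q _ hss
  have a3 := rank_one y s r _ ((mul_comm _ _).trans_le hsy)
  have hLμ : 0 < L / μ := by positivity
  have a4 : L / μ * ‖r‖ ≤ L / μ * (hi * ((1 + L / μ) * ‖q‖)) := by gcongr
  nlinarith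

/-- The eigenvalues of the L-BFGS matrices are bounded away from zero and infinity, with bounds
that do not depend on the dimension. -/
theorem exists_twoLoop_bounds {L μ : ℝ} (hL : 0 < L) (hμ : 0 < μ) (j : ℕ) :
    ∃ lo hi : ℝ, 0 < lo ∧ 0 < hi ∧ ∀ (d : ℕ) (δ : ℝ) (h : List (Vec d × Vec d)),
      min 1 (μ / L ^ 2) ≤ δ → δ ≤ max 1 (1 / μ) → (∀ p ∈ h, CurvaturePair L μ p) →
      h.length ≤ j → ∀ q, lo * ‖q‖ ^ 2 ≤ inner ℝ q (twoLoop δ h q) ∧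
        ‖twoLoop δ h q‖ ≤ hi * ‖q‖ := by
  induction j with
  | zero =>
    refine ⟨min 1 (μ / L ^ 2), max 1 (1 / μ), by positivity, by positivity, ?_⟩
    intro d δ h h1 h2 _ h4 q
    rw [List.length_eq_zero_iff.1 (Nat.le_zero.1 h4)]
    have hδ : 0 < δ := lt_of_lt_of_le (by positivity) h1
    simp only [twoLoop, inner_smul_right, real_inner_self_eq_norm_sq, norm_smul,
      Real.norm_of_nonneg hδ.le]
    exact ⟨by gcongr, by gcongr⟩
  | succ j ih =>
    obtain ⟨lo, hi, hlo, hhi, ih⟩ := ih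
    have hLμ : 0 < L / μ := by positivity
    refine ⟨1 / (1 / lo + L ^ 2 / μ), (1 + L / μ) ^ 2 * hi + 1 / μ, by positivity, by positivity, ?_⟩
    intro d δ h h1 h2 h3 h4
    rcases h with _ | ⟨p, h⟩
    · intro q
      obtain ⟨b1, b2⟩ := ih d δ [] h1 h2 h3 (Nat.zero_le _) q
      refine ⟨le_trans ?_ b1, b2.trans ?_⟩
      · gcongr
        rw [one_div_le (by positivity) hlo]
        have : 0 < L ^ 2 / μ := by positivity
        linarith
      · gcongr
        have : 0 < 1 / μ := by positivity
        have h5 : 1 ≤ (1 + L / μ) ^ 2 := one_le_pow₀ (by linarith)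
        nlinarith
    · have hp := h3 p (by simp)
      have ih' := ih d δ h h1 h2 (fun p hp => h3 p (by simp [hp])) (by simpa using h4)
      exact fun q => ⟨le_inner_twoLoop_cons hL hμ hlo hp (fun q => (ih' q).1) q,
        norm_twoLoop_cons_le hL hμ hhi hp (fun q => (ih' q).2) q⟩

theorem scaling_bounds {L μ : ℝ} (hL : 0 < L) (hμ : 0 < μ) {h : List (Vec d × Vec d)}
    (hh : ∀ p ∈ h, CurvaturePair L μ p) :
    min 1 (μ / L ^ 2) ≤ scaling h ∧ scaling h ≤ max 1 (1 / μ) := by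
  rcases h with _ | ⟨⟨s, y⟩, h⟩
  · simp [scaling]
  obtain ⟨h1, h2, h3⟩ := hh (s, y) (by simp)
  simp only at h1 h2 h3
  have hle := real_inner_le_norm s y
  have hs : 0 < ‖s‖ := by
    by_contra hc
    have : ‖s‖ = 0 := le_antisymm (not_lt.1 hc) (norm_nonneg s)
    rw [this] at hle; linarith
  have hy : 0 < ‖y‖ := by
    by_contra hc
    have : ‖y‖ = 0 := le_antisymm (not_lt.1 hc) (norm_nonneg y)
    rw [this] at hle; linarith
  simp only [scaling, real_inner_self_eq_norm_sq]
  constructor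
  · refine (min_le_right _ _).trans ?_
    rw [div_le_div_iff₀ (by positivity) (by positivity)]
    have : ‖y‖ ^ 2 ≤ (L * ‖s‖) ^ 2 := by gcongr
    nlinarith [mul_le_mul_of_nonneg_left h2 (sq_nonneg L)]
  · refine le_trans ?_ (le_max_right _ _)
    rw [div_le_div_iff₀ (by positivity) hμ]
    have h5 : μ * ‖s‖ ≤ ‖y‖ := by nlinarith
    nlinarith

end TwoLoop

/-! ### Dependence of the run on the batches, and the stored pairs -/

section Run

variable {n d : ℕ} (p : Params) (f : Fin n → Vec d → ℝ) (x₀ m₀ v₀ : Vec d) (K₁ : ℕ)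

theorem dependsOn_run (k : ℕ) :
    DependsOn (fun S => run p f x₀ m₀ v₀ K₁ S k) (Set.Iio k) := by
  induction k with
  | zero => intro S S' _; rfl
  | succ k ih =>
    intro S S' h
    have h1 := ih (x := S) (y := S') fun i hi => h i (lt_trans hi k.lt_succ_self)
    simp only at h1
    simp only [run, h1, h k (Set.mem_Iio.2 k.lt_succ_self)]

theorem dependsOn_comp_run {β : Type*} (φ : State d → β) (k : ℕ) :
    DependsOn (fun S => φ (run p f x₀ m₀ v₀ K₁ S k)) (Set.Iio k) :=
  fun _ _ h => congrArg φ (dependsOn_run p f x₀ m₀ v₀ K₁ k h)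

theorem run_update_self (S : ℕ → Finset (Fin n)) (k : ℕ) (T : Finset (Fin n)) :
    run p f x₀ m₀ v₀ K₁ (Function.update S k T) k = run p f x₀ m₀ v₀ K₁ S k :=
  dependsOn_run p f x₀ m₀ v₀ K₁ k fun _ hi =>
    Function.update_of_ne (ne_of_lt (Set.mem_Iio.1 hi)) _ _

theorem run_update_succ_of_lt (S : ℕ → Finset (Fin n)) {k : ℕ} (hk : k < K₁)
    (T : Finset (Fin n)) :
    run p f x₀ m₀ v₀ K₁ (Function.update S k T) (k + 1)
      = adamStep p k (batchGrad f T (run p f x₀ m₀ v₀ K₁ S k).x) (run p f x₀ m₀ v₀ K₁ S k) := by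
  simp only [run, hk, if_true, run_update_self, Function.update_self]

theorem run_update_succ_of_le (S : ℕ → Finset (Fin n)) {k : ℕ} (hk : K₁ ≤ k)
    (T : Finset (Fin n)) :
    run p f x₀ m₀ v₀ K₁ (Function.update S k T) (k + 1)
      = lbfgsStep p (batchGrad f T) (run p f x₀ m₀ v₀ K₁ S k) := by
  simp only [run, not_lt.2 hk, if_false, run_update_self, Function.update_self]

/-- Before either switchover both runs are pure Adam, so the switchover can be chosen after the Adam
analysis. -/
theorem run_eq_of_le {K K' k : ℕ} (hk : k ≤ K) (hk' : k ≤ K') (S : ℕ → Finset (Fin n)) :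
    run p f x₀ m₀ v₀ K S k = run p f x₀ m₀ v₀ K' S k := by
  induction k with
  | zero => rfl
  | succ k ih =>
    simp only [run, ih (by omega) (by omega), show k < K by omega, show k < K' by omega, if_true]

variable {L μ γ η : ℝ} {f}

theorem run_hist (hf : Assumptions L μ γ η f) (hL : 0 ≤ L) (k : ℕ) (S : ℕ → Finset (Fin n)) :
    (∀ q ∈ (run p f x₀ m₀ v₀ K₁ S k).hist, CurvaturePair L μ q) ∧
      (run p f x₀ m₀ v₀ K₁ S k).hist.length ≤ p.mem := by
  induction k with
  | zero => simp [run]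
  | succ k ih =>
    by_cases hk : k < K₁
    · simp only [run, hk, if_true, adamStep]
      exact ih
    simp only [run, hk, if_false, lbfgsStep]
    split_ifs with h
    · refine ⟨fun q hq => ?_, by simp⟩
      rcases List.mem_cons.1 (List.mem_of_mem_take hq) with rfl | hq
      · refine ⟨h, hf.inner_batchGrad_sub_ge ?_ _ _, hf.norm_batchGrad_sub_le hL _ _ _⟩
        -- The batches here are arbitrary sets; an empty one has zero gradient, so ⟨s, y⟩ = 0 and
        -- nothing is stored.
        rw [Finset.nonempty_iff_ne_empty]
        intro hS
        simp [hS, batchGrad] at h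
      · exact ih.1 q hq
    · exact ih

end Run

/-! ### Linear convergence of L-BFGS -/

section LBFGS

/-- The mean decrease is at least τ·lo·‖∇f‖². The bound on τ lets half of it absorb the η part of
the second-order term; Polyak–Łojasiewicz turns the other half into the contraction. -/
theorem batchAvg_lbfgsStep_le {n d b : ℕ} {L μ γ η lo hi τ : ℝ} {f : Fin n → Vec d → ℝ}
    (hL : 0 < L) (hμ : 0 < μ) (hη : 0 < η) (hf : Assumptions L μ γ η f)
    (hb : 1 ≤ b) (hbn : b ≤ n) (hlo : 0 < lo) (hhi : 0 < hi) (hτ : 0 < τ)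
    (hτ₀ : τ ≤ lo / (L * hi ^ 2 * η)) (p : Params) (hp : p.τ = τ) (xstar : Vec d) (st : State d)
    (hst : ∀ q, lo * ‖q‖ ^ 2 ≤ inner ℝ q (twoLoop (scaling st.hist) st.hist q) ∧
      ‖twoLoop (scaling st.hist) st.hist q‖ ≤ hi * ‖q‖) :
    batchAvg b (fun T => risk f (lbfgsStep p (batchGrad f T) st).x - risk f xstar)
      ≤ (1 - lo * μ * τ) * (risk f st.x - risk f xstar) + L / 2 * hi ^ 2 * τ ^ 2 * γ ^ 2 := by
  have hF := hf.smoothStronglyConvex (hb.trans hbn)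
  set H := twoLoopLinear (scaling st.hist) st.hist
  set G := gradient (risk f) st.x
  have h1 : ∀ T, risk f (lbfgsStep p (batchGrad f T) st).x - risk f xstar
      ≤ (risk f st.x - risk f xstar) + inner ℝ (-τ • (LinearMap.adjoint H) G) (batchGrad f T st.x)
        + (L / 2 * (τ * hi) ^ 2) * ‖batchGrad f T st.x‖ ^ 2 := by
    intro T
    set g := batchGrad f T st.x
    have h := hF.upper st.x (st.x + τ • direction st.hist g)
    have h2 : ‖τ • direction st.hist g‖ ^ 2 ≤ (τ * (hi * ‖g‖)) ^ 2 := by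
      rw [norm_smul, Real.norm_of_nonneg hτ.le, direction_eq_neg, norm_neg]
      have := (hst g).2
      gcongr
      exact this
    rw [add_sub_cancel_left, inner_smul_right, direction_eq_neg, inner_neg_right,
      ← direction_eq_neg] at h
    rw [neg_smul, inner_neg_left, inner_smul_left, LinearMap.adjoint_inner_left]
    simp only [lbfgsStep, hp, conj_trivial]
    have := mul_le_mul_of_nonneg_left h2 (by positivity : 0 ≤ L / 2)
    linarith
  refine (hf.batchAvg_le hb hbn (by positivity) h1).trans ?_
  rw [neg_smul, inner_neg_left, inner_smul_left, LinearMap.adjoint_inner_left]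
  simp only [conj_trivial]
  have h2 : lo * ‖G‖ ^ 2 ≤ inner ℝ G (H G) := (hst G).1
  have h3 := hF.polyak_lojasiewicz hμ st.x xstar
  have h4 : τ * (L * hi ^ 2 * η) ≤ lo := by rwa [le_div_iff₀ (by positivity)] at hτ₀
  have h5 := mul_le_mul_of_nonneg_left h2 hτ.le
  have h6 := mul_le_mul_of_nonneg_left h3 (by positivity : 0 ≤ τ * lo / 2)
  have h7 := mul_le_mul_of_nonneg_right h4 (by positivity : 0 ≤ τ / 2 * ‖G‖ ^ 2)
  linarith

theorem le_geometric_add {u : ℕ → ℝ} {r e : ℝ} (hr : r < 1) (hr0 : 0 ≤ r) (he : 0 ≤ e)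
    (h : ∀ k, u (k + 1) ≤ r * u k + e) (k : ℕ) : u k ≤ r ^ k * u 0 + e / (1 - r) := by
  have h1 : 0 < 1 - r := by linarith
  induction k with
  | zero => simpa using by positivity
  | succ k ih =>
    refine (h k).trans ?_
    have h2 := mul_le_mul_of_nonneg_left ih hr0
    have h3 : r * (e / (1 - r)) + e = e / (1 - r) := by field_simp; ring
    rw [pow_succ']
    linarith

/-- Linear convergence of the function values in the L-BFGS phase. -/
theorem exists_lbfgs_rate {L μ η : ℝ} (hL : 0 < L) (hμ : 0 < μ) (hη : 0 < η) (mem : ℕ) :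
    ∃ τ₀ c N : ℝ, 0 < τ₀ ∧ 0 < c ∧ c * τ₀ < 1 ∧ 0 < N ∧
    ∀ (p : Params), p.mem = mem → 0 < p.τ → p.τ ≤ τ₀ →
    ∀ (γ : ℝ) (d n b : ℕ), 1 ≤ b → b ≤ n →
    ∀ f : Fin n → Vec d → ℝ, Assumptions L μ γ η f → ∀ xstar x₀ m₀ v₀ : Vec d,
    ∀ (Ω : Type*) (_ : MeasurableSpace Ω) (P : Measure Ω) (_ : IsProbabilityMeasure P)
      (B : ℕ → Ω → Finset (Fin n)), IsMinibatchSampling P b B → ∀ K₁ k : ℕ,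
      ∫ ω, (risk f (iterate p f x₀ m₀ v₀ K₁ (fun j => B j ω) (K₁ + k)) - risk f xstar) ∂P
        ≤ (1 - c * p.τ) ^ k *
          ∫ ω, (risk f (iterate p f x₀ m₀ v₀ K₁ (fun j => B j ω) K₁) - risk f xstar) ∂P
          + N * p.τ * γ ^ 2 := by
  obtain ⟨lo, hi, hlo, hhi, H⟩ := exists_twoLoop_bounds hL hμ mem
  -- The second bound on τ gives cτ ≤ 1/2; the last constant is the one-step error divided by
  -- cτ·τγ².
  refine ⟨min (lo / (L * hi ^ 2 * η)) (1 / (2 * (lo * μ))), lo * μ, L * hi ^ 2 / (2 * (lo * μ)),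
    by positivity, by positivity, ?_, by positivity, ?_⟩
  · refine lt_of_le_of_lt (mul_le_mul_of_nonneg_left (min_le_right _ _) (by positivity)) ?_
    have : lo * μ * (1 / (2 * (lo * μ))) = 1 / 2 := by field_simp
    rw [this]; norm_num
  intro p hmem hτ hτ₀ γ d n b hb hbn f hf xstar x₀ m₀ v₀ Ω _ P _ B hB K₁ k
  have hτ1 := hτ₀.trans (min_le_left _ _)
  have hτ2 := hτ₀.trans (min_le_right _ _)
  have hlμ : 0 < lo * μ := by positivity
  have hr1 : lo * μ * p.τ ≤ 1 / 2 := by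
    refine (mul_le_mul_of_nonneg_left hτ2 hlμ.le).trans (le_of_eq ?_)
    field_simp
  have hstep : ∀ k, ∫ ω, (risk f (iterate p f x₀ m₀ v₀ K₁ (fun j => B j ω) (K₁ + (k + 1)))
        - risk f xstar) ∂P
      ≤ (1 - lo * μ * p.τ) *
          ∫ ω, (risk f (iterate p f x₀ m₀ v₀ K₁ (fun j => B j ω) (K₁ + k)) - risk f xstar) ∂P
        + L / 2 * hi ^ 2 * p.τ ^ 2 * γ ^ 2 := by
    intro k
    have hdep : ∀ k, DependsOn (fun S => risk f (iterate p f x₀ m₀ v₀ K₁ S k) - risk f xstar)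
        (Set.Iio k) := fun k =>
      dependsOn_comp_run p f x₀ m₀ v₀ K₁ (fun st => risk f st.x - risk f xstar) k
    have hint := hB.integrable (hdep (K₁ + k))
    have := hB.integral_le_of_batchAvg_le hbn (k := K₁ + k) (hdep (K₁ + k + 1))
      (Φ := fun S => (1 - lo * μ * p.τ) *
        (risk f (iterate p f x₀ m₀ v₀ K₁ S (K₁ + k)) - risk f xstar)
        + L / 2 * hi ^ 2 * p.τ ^ 2 * γ ^ 2)
      (fun x y hxy => by simp only [hdep (K₁ + k) hxy]) ?_
    · refine this.trans (le_of_eq ?_)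
      rw [integral_add (hint.const_mul _) (integrable_const _), integral_const_mul]
      simp
    · intro S
      simp only [iterate, run_update_succ_of_le p f x₀ m₀ v₀ K₁ S (Nat.le_add_right K₁ k)]
      obtain ⟨hh, hlen⟩ := run_hist p x₀ m₀ v₀ K₁ hf hL.le (K₁ + k) S
      obtain ⟨s1, s2⟩ := scaling_bounds hL hμ hh
      exact batchAvg_lbfgsStep_le hL hμ hη hf hb hbn hlo hhi hτ hτ1 p rfl xstar _
        (H d _ _ s1 s2 hh (hlen.trans hmem.le))
  have hfin := le_geometric_add (u := fun k => ∫ ω, (risk f (iterate p f x₀ m₀ v₀ K₁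
    (fun j => B j ω) (K₁ + k)) - risk f xstar) ∂P) (r := 1 - lo * μ * p.τ)
    (e := L / 2 * hi ^ 2 * p.τ ^ 2 * γ ^ 2)
    (by nlinarith) (by linarith) (by positivity) hstep k
  refine hfin.trans (le_of_eq ?_)
  simp only [add_zero]
  congr 1
  field_simp
  ring

end LBFGS

/-! ### Diagonal preconditioners -/

section Diagonal

variable {d : ℕ}

/-- Coordinatewise multiplication by `h`. -/
def diagMul (h : Fin d → ℝ) : Vec d →ₗ[ℝ] Vec d where
  toFun u := WithLp.toLp 2 fun j => h j * u j
  map_add' u w := by ext j; simp [mul_add]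
  map_smul' c u := by ext j; simp [mul_left_comm]

@[simp]
theorem diagMul_apply (h : Fin d → ℝ) (u : Vec d) (j : Fin d) : diagMul h u j = h j * u j := rfl

theorem norm_diagMul_le {h : Fin d → ℝ} {c : ℝ} (hc : ∀ j, |h j| ≤ c) (hc0 : 0 ≤ c) (u : Vec d) :
    ‖diagMul h u‖ ≤ c * ‖u‖ := by
  apply le_of_sq_le_sq _ (by positivity)
  rw [mul_pow, EuclideanSpace.norm_sq_eq, EuclideanSpace.norm_sq_eq, Finset.mul_sum]
  refine Finset.sum_le_sum fun j _ => ?_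
  rw [diagMul_apply, norm_mul, mul_pow, Real.norm_eq_abs]
  have := hc j
  gcongr

theorem le_inner_diagMul {h : Fin d → ℝ} {c : ℝ} (hc : ∀ j, c ≤ h j) (u : Vec d) :
    c * ‖u‖ ^ 2 ≤ inner ℝ u (diagMul h u) := by
  rw [EuclideanSpace.norm_sq_eq, Finset.mul_sum, PiLp.inner_apply]
  refine Finset.sum_le_sum fun j _ => ?_
  simp only [diagMul_apply, Real.norm_eq_abs, sq_abs, RCLike.inner_apply, conj_trivial]
  nlinarith [hc j, mul_self_nonneg (u j)]

end Diagonal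

/-! ### Lyapunov function for preconditioned momentum -/

section HeavyBall

variable {E : Type*} [NormedAddCommGroup E] [InnerProductSpace ℝ E]

theorem norm_convex_combination_sq_le {β : ℝ} (hβ : 0 ≤ β) (hβ' : β ≤ 1) (m g : E) :
    ‖β • m + (1 - β) • g‖ ^ 2 ≤ β * ‖m‖ ^ 2 + (1 - β) * ‖g‖ ^ 2 := by
  have h1 : ‖β • m + (1 - β) • g‖ ≤ β * ‖m‖ + (1 - β) * ‖g‖ := by
    refine (norm_add_le _ _).trans_eq ?_
    rw [norm_smul, norm_smul, Real.norm_of_nonneg hβ, Real.norm_of_nonneg (sub_nonneg.2 hβ')]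
  have h2 : ‖β • m + (1 - β) • g‖ ^ 2 ≤ (β * ‖m‖ + (1 - β) * ‖g‖) ^ 2 := by gcongr
  nlinarith [mul_nonneg (mul_nonneg hβ (sub_nonneg.2 hβ')) (sq_nonneg (‖m‖ - ‖g‖))]

/-- The shifted point moves by a plain preconditioned gradient step -θ H g, up to errors from H ≠ D
and from the change of θ. -/
theorem heavyBall_shift {β : ℝ} (hβ : β < 1) (H D : E →ₗ[ℝ] E) (x m g : E) (θ θ' : ℝ) :
    x - θ • D (β • m + (1 - β) • g) - (β / (1 - β) * θ') • H (β • m + (1 - β) • g)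
      = (x - (β / (1 - β) * θ) • H m) - θ • H g
        + (θ • (H (β • m + (1 - β) • g) - D (β • m + (1 - β) • g))
          + (β / (1 - β) * (θ - θ')) • H (β • m + (1 - β) • g)) := by
  have h : 1 - β ≠ 0 := by linarith
  have e : H (β • m + (1 - β) • g) + (β / (1 - β)) • H (β • m + (1 - β) • g)
      = (β / (1 - β)) • H m + H g := by
    simp only [map_add, map_smul]
    match_scalars <;> field_simp <;> ring
  linear_combination (norm := module) (-θ) • e

/-- The Lyapunov function of the preconditioned heavy-ball method. -/
def heavyBallPotential (F : E → ℝ) (xstar : E) (H : E →ₗ[ℝ] E) (β κ θ : ℝ) (x m : E) : ℝ :=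
  F (x - (β / (1 - β) * θ) • H m) - F xstar + κ * θ ^ 2 * ‖m‖ ^ 2

variable [CompleteSpace E] {F : E → ℝ} {L μ : ℝ}

/-- One step of the heavy-ball method, whose preconditioner `D` is close to `H`. -/
theorem SmoothStronglyConvex.heavyBallPotential_le (hF : SmoothStronglyConvex L μ F) (hL : 0 < L)
    {H D : E →ₗ[ℝ] E} {β κ θ θ' h ω : ℝ} (hβ : 0 < β) (hβ' : β < 1) (hκ : 0 ≤ κ) (hθ' : 0 ≤ θ')
    (hθθ : θ' ≤ θ) (hθ : θ ≤ 1) (hω : θ - θ' ≤ ω * θ ^ 2) (hω0 : 0 ≤ ω) (hh : 0 ≤ h)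
    (hH : ∀ u, ‖H u‖ ≤ h * ‖u‖) (xstar x m g : E)
    (hD : ‖H (β • m + (1 - β) • g) - D (β • m + (1 - β) • g)‖ ≤ θ * ‖β • m + (1 - β) • g‖) :
    heavyBallPotential F xstar H β κ θ' (x - θ • D (β • m + (1 - β) • g)) (β • m + (1 - β) • g)
      ≤ F (x - (β / (1 - β) * θ) • H m) - F xstar
        - θ * inner ℝ (gradient F (x - (β / (1 - β) * θ) • H m)) (H g)
        + 1 / 2 * θ ^ 2 * ‖gradient F (x - (β / (1 - β) * θ) • H m)‖ ^ 2
        + θ ^ 2 * (κ + (L + 1 / 2) * (1 + β / (1 - β) * ω * h) ^ 2)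
          * (β * ‖m‖ ^ 2 + (1 - β) * ‖g‖ ^ 2)
        + θ ^ 2 * (L * h ^ 2) * ‖g‖ ^ 2 := by
  have hθ0 : 0 ≤ θ := hθ'.trans hθθ
  rw [heavyBallPotential, heavyBall_shift hβ']
  set z := x - (β / (1 - β) * θ) • H m
  have hm := norm_convex_combination_sq_le hβ.le hβ'.le m g
  set m' := β • m + (1 - β) • g
  set ρ := β / (1 - β) with hρ
  have hρ0 : 0 ≤ ρ := div_nonneg hβ.le (by linarith)
  set e := θ • (H m' - D m') + (ρ * (θ - θ')) • H m'
  set ε := 1 + ρ * ω * h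
  have hε : 0 ≤ ε := by positivity
  -- Both errors are second order: ‖(H - D)m'‖ ≤ θ‖m'‖ and θ - θ' ≤ ωθ².
  have he : ‖e‖ ≤ θ ^ 2 * ε * ‖m'‖ := by
    refine (norm_add_le _ _).trans ?_
    rw [norm_smul, norm_smul, Real.norm_of_nonneg hθ0,
      Real.norm_of_nonneg (mul_nonneg hρ0 (sub_nonneg.2 hθθ))]
    have h1 : θ * ‖H m' - D m'‖ ≤ θ * (θ * ‖m'‖) := by gcongr
    have h2 : ρ * (θ - θ') * ‖H m'‖ ≤ ρ * (ω * θ ^ 2) * (h * ‖m'‖) := by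
      have := hH m'
      have : 0 ≤ θ - θ' := sub_nonneg.2 hθθ
      gcongr
    refine (add_le_add h1 h2).trans (le_of_eq ?_)
    simp only [ε]; ring
  have hup := hF.upper z (z - θ • H g + e)
  have e1 : z - θ • H g + e - z = e - θ • H g := by abel
  rw [e1, inner_sub_right, inner_smul_right] at hup
  set G := gradient F z
  have hGe : inner ℝ G e ≤ 1 / 2 * θ ^ 2 * ‖G‖ ^ 2 + 1 / 2 * θ ^ 2 * ε ^ 2 * ‖m'‖ ^ 2 := by
    refine (real_inner_le_norm _ _).trans ?_
    have h1 : ‖G‖ * ‖e‖ ≤ ‖G‖ * (θ ^ 2 * ε * ‖m'‖) := by gcongr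
    nlinarith [mul_nonneg (sq_nonneg θ) (sq_nonneg (‖G‖ - ε * ‖m'‖))]
  have hq : ‖e - θ • H g‖ ^ 2 ≤ 2 * (θ ^ 2 * ε ^ 2 * ‖m'‖ ^ 2) + 2 * (θ ^ 2 * h ^ 2 * ‖g‖ ^ 2) := by
    have h1 : ‖e - θ • H g‖ ≤ ‖e‖ + θ * ‖H g‖ := by
      refine (norm_sub_le _ _).trans_eq ?_
      rw [norm_smul, Real.norm_of_nonneg hθ0]
    have h2 : ‖e‖ ≤ θ * ε * ‖m'‖ := by
      refine he.trans ?_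
      have : θ ^ 2 ≤ θ := by nlinarith
      gcongr
    have h3 : θ * ‖H g‖ ≤ θ * (h * ‖g‖) := by have := hH g; gcongr
    have h4 : ‖e - θ • H g‖ ^ 2 ≤ (θ * ε * ‖m'‖ + θ * (h * ‖g‖)) ^ 2 := by
      gcongr; linarith
    nlinarith [sq_nonneg (θ * ε * ‖m'‖ - θ * (h * ‖g‖))]
  have hκm : κ * θ' ^ 2 * ‖m'‖ ^ 2 ≤ κ * θ ^ 2 * ‖m'‖ ^ 2 := by gcongr
  have hq2 := mul_le_mul_of_nonneg_left hq (by positivity : 0 ≤ L / 2)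
  have hm2 := mul_le_mul_of_nonneg_left hm
    (by positivity : 0 ≤ θ ^ 2 * (κ + (L + 1 / 2) * ε ^ 2))
  linarith

/-- The gradient at the iterate in terms of the gradient at the shifted point. -/
theorem SmoothStronglyConvex.norm_gradient_sub_shift_le (hF : SmoothStronglyConvex L μ F)
    (hL : 0 < L) {H : E →ₗ[ℝ] E} {h r : ℝ} (hr : 0 ≤ r) (hH : ∀ u, ‖H u‖ ≤ h * ‖u‖) (x m : E) :
    ‖gradient F x - gradient F (x - r • H m)‖ ≤ L * h * r * ‖m‖ := by
  refine (hF.lipschitz _ _).trans ?_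
  rw [sub_sub_cancel, norm_smul, Real.norm_of_nonneg hr]
  have := mul_le_mul_of_nonneg_left (hH m) (mul_nonneg hL.le hr)
  linarith

end HeavyBall

/-! ### Expected decrease of the Lyapunov function -/

section Drift

set_option maxHeartbeats 1000000 in
/-- Expected decrease of the Lyapunov function. -/
theorem heavyBall_drift {n d b : ℕ} {L μ γ η : ℝ} {f : Fin n → Vec d → ℝ}
    (hL : 0 < L) (hμ : 0 < μ) (hη : 0 < η) (hf : Assumptions L μ γ η f)
    (hb : 1 ≤ b) (hbn : b ≤ n) {H : Vec d →ₗ[ℝ] Vec d} {D : Finset (Fin n) → Vec d →ₗ[ℝ] Vec d}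
    {β κ θ θ' h lo ω R q : ℝ} (hβ : 0 < β) (hβ' : β < 1) (hκ : 0 ≤ κ) (hθ' : 0 ≤ θ')
    (hθθ : θ' ≤ θ) (hθ : θ ≤ 1) (hω : θ - θ' ≤ ω * θ ^ 2) (hω0 : 0 ≤ ω) (hh : 0 ≤ h)
    (hH : ∀ u, ‖H u‖ ≤ h * ‖u‖) (hHlo : ∀ u, lo * ‖u‖ ^ 2 ≤ inner ℝ u (H u))
    (hR : R = L * h * (β / (1 - β)))
    (hq : q = L * h ^ 2 + (κ + (L + 1 / 2) * (1 + β / (1 - β) * ω * h) ^ 2) * (1 - β))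
    (hκβ : (L + 1 / 2) * (1 + β / (1 - β) * ω * h) ^ 2 * β + h ^ 2 * R ^ 2 / 2
      ≤ κ * (1 - β) / 2)
    (hθ1 : θ * (1 + 2 * q * η) ≤ lo / 2)
    (hθ2 : θ * (2 * q * η * R ^ 2 + κ * (lo * μ)) ≤ κ * (1 - β) / 2)
    (xstar x m : Vec d)
    (hD : ∀ T, ‖H (β • m + (1 - β) • batchGrad f T x) - D T (β • m + (1 - β) • batchGrad f T x)‖
      ≤ θ * ‖β • m + (1 - β) • batchGrad f T x‖) :
    batchAvg b (fun T => heavyBallPotential (risk f) xstar H β κ θ'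
        (x - θ • D T (β • m + (1 - β) • batchGrad f T x)) (β • m + (1 - β) • batchGrad f T x))
      ≤ (1 - lo * μ * θ) * heavyBallPotential (risk f) xstar H β κ θ x m
        + q * γ ^ 2 * θ ^ 2 := by
  have hF := hf.smoothStronglyConvex (hb.trans hbn)
  have hθ0 : 0 ≤ θ := hθ'.trans hθθ
  have hρ : 0 ≤ β / (1 - β) := div_nonneg hβ.le (by linarith)
  have h1β : 0 < 1 - β := by linarith
  have hq0 : 0 ≤ q := by rw [hq]; positivity
  set z := x - (β / (1 - β) * θ) • H m with hz
  set P := (L + 1 / 2) * (1 + β / (1 - β) * ω * h) ^ 2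
  have hP : 0 ≤ P := by positivity
  set Gz := gradient (risk f) z
  set Gx := gradient (risk f) x
  have hpt : ∀ T, heavyBallPotential (risk f) xstar H β κ θ'
        (x - θ • D T (β • m + (1 - β) • batchGrad f T x)) (β • m + (1 - β) • batchGrad f T x)
      ≤ (risk f z - risk f xstar + 1 / 2 * θ ^ 2 * ‖Gz‖ ^ 2 + θ ^ 2 * (κ + P) * (β * ‖m‖ ^ 2))
        + inner ℝ (-θ • LinearMap.adjoint H Gz) (batchGrad f T x)
        + (θ ^ 2 * q) * ‖batchGrad f T x‖ ^ 2 := by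
    intro T
    have h1 := hF.heavyBallPotential_le hL hβ hβ' hκ hθ' hθθ hθ hω hω0 hh hH xstar x m
      (batchGrad f T x) (hD T)
    rw [neg_smul, inner_neg_left, inner_smul_left, LinearMap.adjoint_inner_left, hq]
    simp only [conj_trivial]
    refine h1.trans (le_of_eq ?_)
    ring
  refine (hf.batchAvg_le hb hbn (by positivity) hpt).trans ?_
  rw [neg_smul, inner_neg_left, inner_smul_left, LinearMap.adjoint_inner_left,
    heavyBallPotential, ← hz]
  simp only [conj_trivial]
  have hdiff : ‖Gx - Gz‖ ≤ R * θ * ‖m‖ := by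
    have := hF.norm_gradient_sub_shift_le hL (mul_nonneg hρ hθ0) hH x m
    rw [hR]
    refine this.trans (le_of_eq ?_)
    ring
  have hR0 : 0 ≤ R := by rw [hR]; positivity
  have hinner : - (θ * inner ℝ Gz (H Gx)) ≤ - θ * (lo * ‖Gz‖ ^ 2)
      + (1 / 2 * θ ^ 2 * ‖Gz‖ ^ 2 + 1 / 2 * θ ^ 2 * (h ^ 2 * R ^ 2) * ‖m‖ ^ 2) := by
    have e : Gx = Gz + (Gx - Gz) := by abel
    rw [e, map_add, inner_add_right]
    have h1 := hHlo Gz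
    have h2 : ‖H (Gx - Gz)‖ ≤ h * (R * θ * ‖m‖) := (hH _).trans (by gcongr)
    have h3 : - inner ℝ Gz (H (Gx - Gz)) ≤ ‖Gz‖ * (h * (R * θ * ‖m‖)) :=
      (neg_le.1 (neg_le_of_abs_le (abs_real_inner_le_norm _ _))).trans (by gcongr)
    have h4 := mul_le_mul_of_nonneg_left h1 hθ0
    have h5 := mul_le_mul_of_nonneg_left h3 hθ0
    nlinarith [mul_nonneg (sq_nonneg θ) (sq_nonneg (‖Gz‖ - h * R * ‖m‖))]
  have hGx : ‖Gx‖ ^ 2 ≤ 2 * ‖Gz‖ ^ 2 + 2 * R ^ 2 * θ ^ 2 * ‖m‖ ^ 2 := by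
    have h1 : ‖Gx‖ ≤ ‖Gz‖ + R * θ * ‖m‖ := by
      have : ‖Gx‖ ≤ ‖Gz‖ + ‖Gx - Gz‖ := by simpa using norm_add_le Gz (Gx - Gz)
      linarith
    have h2 : ‖Gx‖ ^ 2 ≤ (‖Gz‖ + R * θ * ‖m‖) ^ 2 := by gcongr
    nlinarith [sq_nonneg (‖Gz‖ - R * θ * ‖m‖)]
  have hpl := hF.polyak_lojasiewicz hμ z xstar
  have hlo : 0 ≤ lo := by
    have : 0 ≤ θ * (1 + 2 * q * η) := by positivity
    linarith
  have t1 := mul_le_mul_of_nonneg_left hGx (by positivity : 0 ≤ θ ^ 2 * q * η)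
  -- Budget: of the decrease θ·lo·‖∇f(z)‖², half absorbs the squared-gradient errors and half gives
  -- the contraction. Of the slack κ(1 - β) left by the decay of the momentum, `hκβ` and `hθ2` take
  -- half each.
  have t2 := mul_le_mul_of_nonneg_right hθ1 (by positivity : 0 ≤ θ * ‖Gz‖ ^ 2)
  have t3 := mul_le_mul_of_nonneg_left hpl (by positivity : 0 ≤ θ * lo / 2)
  have t4 := mul_le_mul_of_nonneg_right hκβ (by positivity : 0 ≤ θ ^ 2 * ‖m‖ ^ 2)
  have t5 := mul_le_mul_of_nonneg_right hθ2 (by positivity : 0 ≤ θ ^ 2 * ‖m‖ ^ 2)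
  have t6 : 2 * q * η * R ^ 2 * θ ^ 2 * (θ ^ 2 * ‖m‖ ^ 2)
      ≤ 2 * q * η * R ^ 2 * θ * (θ ^ 2 * ‖m‖ ^ 2) := by
    have : θ ^ 2 ≤ θ := pow_le_of_le_one hθ0 hθ two_ne_zero
    have hc : 0 ≤ 2 * q * η * R ^ 2 := by positivity
    exact mul_le_mul_of_nonneg_right (mul_le_mul_of_nonneg_left this hc) (by positivity)
  linarith

end Drift

/-! ### The 1/k rate -/

section Schedule

theorem le_div_of_contraction {u : ℕ → ℝ} {l A e k₀ Q : ℝ} {K : ℕ} (hk₀ : 0 < k₀) (hA : l * A = 2)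
    (hu0 : u 0 ≤ Q / k₀) (hQ : e * A ^ 2 ≤ Q) (hQ0 : 0 ≤ Q) (hlk : 2 ≤ k₀)
    (hu : ∀ k < K, u (k + 1) ≤ (1 - l * (A / (k + k₀))) * u k + e * (A / (k + k₀)) ^ 2)
    {k : ℕ} (hk : k ≤ K) : u k ≤ Q / (k + k₀) := by
  induction k with
  | zero => simpa using hu0
  | succ k ih =>
    have hs : 0 < (k : ℝ) + k₀ := by positivity
    have e1 : l * (A / (k + k₀)) = 2 / (k + k₀) := by rw [← hA]; ring
    have h1 : 0 ≤ 1 - l * (A / (k + k₀)) := by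
      rw [e1, sub_nonneg, div_le_one hs]
      have : (0 : ℝ) ≤ k := Nat.cast_nonneg k
      linarith
    refine (hu k (by omega)).trans ?_
    have h2 := mul_le_mul_of_nonneg_left (ih (by omega)) h1
    rw [e1] at h2 ⊢
    have h3 : e * (A / (k + k₀)) ^ 2 ≤ Q / (k + k₀) ^ 2 := by
      rw [div_pow, ← mul_div_assoc]; gcongr
    -- With s = k + k₀ this is (s - 1)(s + 1) ≤ s²; the factor 2 in the contraction leaves room for
    -- the noise term Q/s².
    have h4 : (1 - 2 / ((k : ℝ) + k₀)) * (Q / (k + k₀)) + Q / (k + k₀) ^ 2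
        ≤ Q / ((k + 1 : ℕ) + k₀) := by
      push_cast
      rw [show (1 - 2 / ((k : ℝ) + k₀)) * (Q / (k + k₀)) + Q / (k + k₀) ^ 2
        = Q * (k + k₀ - 1) / (k + k₀) ^ 2 by field_simp; ring,
        div_le_div_iff₀ (by positivity) (by positivity)]
      nlinarith
    linarith

end Schedule

/-! ### Crude bounds for Adam on a finite horizon -/

section AdamBounds

theorem abs_inv_sqrt_sub_le {a s t : ℝ} (ha : 0 < a) (hs : a ≤ s) (ht : a ≤ t) :
    |1 / √s - 1 / √t| ≤ |s - t| / (a * √a) := by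
  have hs0 : 0 < √s := Real.sqrt_pos.2 (ha.trans_le hs)
  have ht0 : 0 < √t := Real.sqrt_pos.2 (ha.trans_le ht)
  have ha0 : 0 < √a := Real.sqrt_pos.2 ha
  have has : √a ≤ √s := Real.sqrt_le_sqrt hs
  have hat : √a ≤ √t := Real.sqrt_le_sqrt ht
  have e1 : 1 / √s - 1 / √t = (√t - √s) / (√s * √t) := by field_simp
  have e2 : |s - t| = |√t - √s| * (√s + √t) := by
    rw [← abs_of_pos (add_pos hs0 ht0), ← abs_mul, abs_sub_comm]
    congr 1
    nlinarith [Real.sq_sqrt (ha.le.trans hs), Real.sq_sqrt (ha.le.trans ht)]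
  rw [e1, abs_div, abs_of_pos (mul_pos hs0 ht0), div_le_div_iff₀ (by positivity) (by positivity), e2,
    mul_assoc]
  refine mul_le_mul_of_nonneg_left ?_ (abs_nonneg _)
  have h1 : a = √a * √a := (Real.mul_self_sqrt ha.le).symm
  have h2 : √a * √a ≤ √s * √t := by gcongr
  calc a * √a = (√a * √a) * √a := by rw [← h1]
    _ ≤ (√s * √t) * √a := by gcongr
    _ ≤ (√s * √t) * (√s + √t) := by gcongr; linarith
    _ = _ := by ring

variable {d n : ℕ}

theorem adamStep_x (p : Params) (k : ℕ) (g : Vec d) (st : State d) :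
    (adamStep p k g st).x = st.x
      - (p.α k * (√(1 - p.β₂ ^ (k + 1)) / (1 - p.β₁ ^ (k + 1)))) •
        diagMul (fun j => 1 / √((adamStep p k g st).v j + p.a)) (p.β₁ • st.m + (1 - p.β₁) • g) := by
  ext j
  simp only [adamStep, PiLp.sub_apply, PiLp.smul_apply, diagMul_apply, smul_eq_mul]
  ring

variable {L μ γ η : ℝ} {f : Fin n → Vec d → ℝ}

/-- Holds for every batch rather than on average, at the price of a factor n; this is harmless,
since only the choice of β₂ uses it. -/
theorem norm_batchGrad_le_sqrt (hf : Assumptions L μ γ η f) (hL : 0 < L) (hη : 0 < η) (hn : 0 < n)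
    {xstar x₀ : Vec d} (hmin : ∀ x, risk f xstar ≤ risk f x) {Δ : ℝ}
    (hΔ : risk f x₀ - risk f xstar ≤ Δ) (T : Finset (Fin n)) :
    ‖batchGrad f T x₀‖ ≤ √(n * (γ ^ 2 + η * (2 * L * Δ))) := by
  apply Real.le_sqrt_of_sq_le
  have hn' : (0 : ℝ) < n := by exact_mod_cast hn
  have h1 := hf.growth x₀
  rw [one_div, inv_mul_le_iff₀ hn'] at h1
  have h2 := (hf.smoothStronglyConvex hn).norm_gradient_sq_le hL hmin x₀
  calc ‖batchGrad f T x₀‖ ^ 2 ≤ (1 / (T.card : ℝ)) * ∑ i ∈ T, ‖gradient (f i) x₀‖ ^ 2 :=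
        Assumptions.norm_batchGrad_sq_le T x₀
    _ ≤ 1 * ∑ i ∈ T, ‖gradient (f i) x₀‖ ^ 2 := by
        gcongr
        rcases T.eq_empty_or_nonempty with rfl | hT
        · simp
        · rw [div_le_one (by exact_mod_cast hT.card_pos)]
          exact_mod_cast hT.card_pos
    _ ≤ ∑ i, ‖gradient (f i) x₀‖ ^ 2 := by
        rw [one_mul]
        exact Finset.sum_le_sum_of_subset_of_nonneg (Finset.subset_univ _)
          fun _ _ _ => sq_nonneg _
    _ ≤ _ := h1.trans (by
        gcongr
        refine h2.trans ?_
        gcongr)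

variable {p : Params} {x₀ m₀ v₀ : Vec d} {K₁ : ℕ} {θ : ℕ → ℝ} {R₀ M : ℝ}

theorem norm_batchGrad_run_le (hf : Assumptions L μ γ η f) (hL : 0 ≤ L)
    (hR₀ : ∀ T, ‖batchGrad f T x₀‖ ≤ R₀) (T : Finset (Fin n)) (x : Vec d) :
    ‖batchGrad f T x‖ ≤ R₀ + L * ‖x - x₀‖ := by
  have h1 := hf.norm_batchGrad_sub_le hL T x x₀
  have h2 := norm_add_le (batchGrad f T x₀) (batchGrad f T x - batchGrad f T x₀)
  rw [add_sub_cancel] at h2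
  linarith [hR₀ T]

/-- The state of Adam stays in a bounded set on every finite horizon. -/
theorem adam_run_bounded (hf : Assumptions L μ γ η f) (hL : 0 ≤ L) (hβ₁ : 0 < p.β₁)
    (hβ₁' : p.β₁ < 1) (hβ₂ : 0 ≤ p.β₂) (hβ₂' : p.β₂ ≤ 1) (ha : 0 < p.a)
    (hα : ∀ k, p.α k * (√(1 - p.β₂ ^ (k + 1)) / (1 - p.β₁ ^ (k + 1))) = θ k)
    (hθ : ∀ k, 0 ≤ θ k) (hθ' : ∀ k, θ k ≤ 1) (hR₀ : ∀ T, ‖batchGrad f T x₀‖ ≤ R₀)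
    (hM : ‖m₀‖ ≤ M) (hv₀ : ∀ j, 0 ≤ v₀ j) (S : ℕ → Finset (Fin n)) {k : ℕ} (hk : k ≤ K₁) :
    (∀ j, 0 ≤ (run p f x₀ m₀ v₀ K₁ S k).v j) ∧
      ‖(run p f x₀ m₀ v₀ K₁ S k).m‖ + ‖(run p f x₀ m₀ v₀ K₁ S k).x - x₀‖ + R₀
        ≤ ((1 + 1 / √p.a) * (1 + L) + 1) ^ k * (M + R₀) := by
  induction k with
  | zero => simpa [run] using ⟨hv₀, hM⟩
  | succ k ih =>
    obtain ⟨ih1, ih2⟩ := ih (by omega)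
    have hrun : run p f x₀ m₀ v₀ K₁ S (k + 1) = adamStep p k
        (batchGrad f (S k) (run p f x₀ m₀ v₀ K₁ S k).x) (run p f x₀ m₀ v₀ K₁ S k) := by
      simp only [run, show k < K₁ by omega, if_true]
    set st := run p f x₀ m₀ v₀ K₁ S k
    set g := batchGrad f (S k) st.x with hg
    have hv : ∀ j, 0 ≤ (adamStep p k g st).v j := fun j => by
      have := mul_nonneg hβ₂ (ih1 j)
      have := mul_nonneg (sub_nonneg.2 hβ₂') (mul_self_nonneg (g j))
      simp only [adamStep]
      linarith
    rw [hrun]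
    refine ⟨hv, ?_⟩
    have hgn : ‖g‖ ≤ R₀ + L * ‖st.x - x₀‖ := norm_batchGrad_run_le hf hL hR₀ _ _
    have hR0 : 0 ≤ R₀ := (norm_nonneg _).trans (hR₀ ∅)
    -- Including R₀ in the controlled sum makes it dominate the gradient bound, so it grows at most
    -- by a fixed factor per step.
    have hm : ‖p.β₁ • st.m + (1 - p.β₁) • g‖ ≤ (1 + L) * (‖st.m‖ + ‖st.x - x₀‖ + R₀) := by
      refine (norm_add_le _ _).trans ?_
      rw [norm_smul, norm_smul, Real.norm_of_nonneg hβ₁.le,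
        Real.norm_of_nonneg (sub_nonneg.2 hβ₁'.le)]
      have h1 := mul_le_mul_of_nonneg_right hβ₁'.le (norm_nonneg st.m)
      have h2 := mul_nonneg hβ₁.le (norm_nonneg g)
      have h3 := mul_nonneg hL (norm_nonneg st.m)
      have h4 := mul_nonneg hL hR0
      have h5 := norm_nonneg (st.x - x₀)
      linarith
    have hsa : 0 < √p.a := Real.sqrt_pos.2 ha
    have hD : ∀ j, |1 / √((adamStep p k g st).v j + p.a)| ≤ 1 / √p.a := fun j => by
      rw [abs_of_nonneg (by positivity)]
      have := Real.sqrt_le_sqrt (show p.a ≤ (adamStep p k g st).v j + p.a by linarith [hv j])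
      gcongr
    have hx : ‖(adamStep p k g st).x - x₀‖ ≤ ‖st.x - x₀‖
        + 1 / √p.a * ‖p.β₁ • st.m + (1 - p.β₁) • g‖ := by
      rw [adamStep_x, hα, sub_right_comm]
      refine (norm_sub_le _ _).trans ?_
      rw [norm_smul, Real.norm_of_nonneg (hθ k)]
      have h1 := norm_diagMul_le hD (by positivity) (p.β₁ • st.m + (1 - p.β₁) • g)
      have h2 := mul_le_of_le_one_left (norm_nonneg (diagMul
        (fun j => 1 / √((adamStep p k g st).v j + p.a)) (p.β₁ • st.m + (1 - p.β₁) • g))) (hθ' k)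
      linarith
    have hm' : ‖(adamStep p k g st).m‖ = ‖p.β₁ • st.m + (1 - p.β₁) • g‖ := rfl
    rw [hm', pow_succ', mul_assoc]
    set u := ‖st.m‖ + ‖st.x - x₀‖ + R₀ with hu
    have hst : ‖st.x - x₀‖ + R₀ ≤ u := by linarith [norm_nonneg st.m]
    have h5 := mul_le_mul_of_nonneg_left hm (by positivity : 0 ≤ 1 + 1 / √p.a)
    have h6 := mul_le_mul_of_nonneg_left ih2 (by positivity : 0 ≤ (1 + 1 / √p.a) * (1 + L) + 1)
    linarith

/-- The second moments of Adam move slowly if `β₂` is close to `1`. -/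
theorem abs_adam_v_sub_le {V G : ℝ} (hβ₂ : 0 ≤ p.β₂) (hβ₂' : p.β₂ ≤ 1)
    (hv₀ : ∀ j, 0 ≤ v₀ j ∧ v₀ j ≤ V) (S : ℕ → Finset (Fin n))
    (hG : ∀ k < K₁, ‖batchGrad f (S k) (run p f x₀ m₀ v₀ K₁ S k).x‖ ≤ G) {k : ℕ} (hk : k ≤ K₁)
    (j : Fin d) :
    |(run p f x₀ m₀ v₀ K₁ S k).v j - v₀ j| ≤ k * ((1 - p.β₂) * (G ^ 2 + V)) := by
  induction k with
  | zero => simp [run]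
  | succ k ih =>
    have hk' : k < K₁ := by omega
    have ih := ih (by omega)
    have hg := hG k hk'
    simp only [run, hk', if_true, adamStep]
    set st := run p f x₀ m₀ v₀ K₁ S k
    set g := batchGrad f (S k) st.x
    have hgj : g j * g j ≤ G ^ 2 := by
      have h1 : |g j| ≤ G := (PiLp.norm_apply_le g j).trans hg
      rw [← sq, ← sq_abs]
      gcongr
    have h1 : |g j * g j - v₀ j| ≤ G ^ 2 + V := by
      have := mul_self_nonneg (g j)
      obtain ⟨h2, h3⟩ := hv₀ j
      rw [abs_le]; constructor <;> nlinarith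
    have e : p.β₂ * st.v j + (1 - p.β₂) * (g j * g j) - v₀ j
        = p.β₂ * (st.v j - v₀ j) + (1 - p.β₂) * (g j * g j - v₀ j) := by ring
    rw [e]
    refine (abs_add_le _ _).trans ?_
    rw [abs_mul, abs_mul, abs_of_nonneg hβ₂, abs_of_nonneg (sub_nonneg.2 hβ₂')]
    have h2 := mul_le_mul_of_nonneg_left h1 (sub_nonneg.2 hβ₂')
    have h3 := mul_le_of_le_one_left (abs_nonneg (st.v j - v₀ j)) hβ₂'
    push_cast
    linarith

end AdamBounds

/-! ### The Lyapunov function at the start and at the end -/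

section Potential

variable {E : Type*} [NormedAddCommGroup E] [InnerProductSpace ℝ E] [CompleteSpace E]
  {F : E → ℝ} {L μ : ℝ}

theorem SmoothStronglyConvex.heavyBallPotential_initial_le (hF : SmoothStronglyConvex L μ F)
    (hL : 0 < L) {xstar : E} (hmin : ∀ x, F xstar ≤ F x) {H : E →ₗ[ℝ] E} {β κ θ h M Δ : ℝ}
    (hβ : 0 < β) (hβ' : β < 1) (hκ : 0 ≤ κ) (hθ : 0 ≤ θ) (hθ' : θ ≤ 1) (hh : 0 ≤ h)
    (hH : ∀ u, ‖H u‖ ≤ h * ‖u‖) {x m : E} (hx : F x - F xstar ≤ Δ) (hm : ‖m‖ ≤ M) :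
    heavyBallPotential F xstar H β κ θ x m
      ≤ Δ + L * Δ + (1 / 2 + L / 2) * (β / (1 - β) * h * M) ^ 2 + κ * M ^ 2 := by
  have hρ : 0 ≤ β / (1 - β) := div_nonneg hβ.le (by linarith)
  have hM : 0 ≤ M := (norm_nonneg m).trans hm
  have hs : ‖(β / (1 - β) * θ) • H m‖ ≤ β / (1 - β) * h * M := by
    rw [norm_smul, Real.norm_of_nonneg (by positivity)]
    calc β / (1 - β) * θ * ‖H m‖ ≤ β / (1 - β) * 1 * (h * M) := by
          have : ‖H m‖ ≤ h * M := (hH m).trans (by gcongr)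
          gcongr
      _ = _ := by ring
  have hup := hF.upper x (x - (β / (1 - β) * θ) • H m)
  rw [sub_sub_cancel_left, norm_neg] at hup
  set e := (β / (1 - β) * θ) • H m
  have hin := abs_real_inner_le_norm (gradient F x) (-e)
  rw [norm_neg] at hin
  have hin := (le_abs_self _).trans hin
  have hg := hF.norm_gradient_sq_le hL hmin x
  have hs2 : ‖e‖ ^ 2 ≤ (β / (1 - β) * h * M) ^ 2 := by gcongr
  have hκm : κ * θ ^ 2 * ‖m‖ ^ 2 ≤ κ * 1 ^ 2 * M ^ 2 := by gcongr
  have hLΔ := mul_le_mul_of_nonneg_left hx hL.le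
  have hs3 := mul_le_mul_of_nonneg_left hs2 hL.le
  rw [heavyBallPotential]
  nlinarith [sq_nonneg (‖gradient F x‖ - ‖e‖)]

/-- The suboptimality at z bounds the gradient there; the momentum term pays for moving the gradient
from z back to x. -/
theorem SmoothStronglyConvex.norm_gradient_sq_le_heavyBallPotential
    (hF : SmoothStronglyConvex L μ F) (hL : 0 < L) {xstar : E} (hmin : ∀ x, F xstar ≤ F x)
    {H : E →ₗ[ℝ] E} {β κ θ h : ℝ} (hβ : 0 < β) (hβ' : β < 1) (hκ : 0 < κ) (hθ : 0 ≤ θ)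
    (hh : 0 ≤ h) (hH : ∀ u, ‖H u‖ ≤ h * ‖u‖) (x m : E) :
    ‖gradient F x‖ ^ 2 ≤ (4 * L + 2 * (L * h * (β / (1 - β))) ^ 2 / κ)
      * heavyBallPotential F xstar H β κ θ x m := by
  have hρ : 0 ≤ β / (1 - β) := div_nonneg hβ.le (by linarith)
  have hd := hF.norm_gradient_sub_shift_le hL (mul_nonneg hρ hθ) hH x m
  rw [heavyBallPotential]
  set z := x - (β / (1 - β) * θ) • H m
  have hz := hF.norm_gradient_sq_le hL hmin z
  have hFz := hmin z
  set R := L * h * (β / (1 - β)) with hR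
  have hR0 : 0 ≤ R := by positivity
  have hd' : ‖gradient F x‖ ≤ ‖gradient F z‖ + R * θ * ‖m‖ := by
    have : ‖gradient F x‖ ≤ ‖gradient F z‖ + ‖gradient F x - gradient F z‖ := by
      simpa using norm_add_le (gradient F z) (gradient F x - gradient F z)
    have e : L * h * (β / (1 - β) * θ) * ‖m‖ = R * θ * ‖m‖ := by rw [hR]; ring
    linarith
  have h1 : ‖gradient F x‖ ^ 2 ≤ (‖gradient F z‖ + R * θ * ‖m‖) ^ 2 := by gcongr
  have h2 : ‖gradient F x‖ ^ 2 ≤ 2 * ‖gradient F z‖ ^ 2 + 2 * R ^ 2 * (θ ^ 2 * ‖m‖ ^ 2) := by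
    nlinarith [sq_nonneg (‖gradient F z‖ - R * θ * ‖m‖)]
  have h3 : 2 * R ^ 2 / κ * (κ * θ ^ 2 * ‖m‖ ^ 2) = 2 * R ^ 2 * (θ ^ 2 * ‖m‖ ^ 2) := by
    field_simp
  have h4 : 0 ≤ 2 * R ^ 2 / κ * (F z - F xstar) := mul_nonneg (by positivity) (by linarith)
  have h5 : 0 ≤ 4 * L * (κ * θ ^ 2 * ‖m‖ ^ 2) := by positivity
  nlinarith

end Potential

/-! ### Complexity of the Adam phase -/

section AdamPhase

variable {d n b : ℕ} {L μ γ η : ℝ} {f : Fin n → Vec d → ℝ} {p : Params} {x₀ m₀ v₀ : Vec d}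
  {K₁ : ℕ} {θ : ℕ → ℝ}

theorem integral_heavyBallPotential_run_succ_le
    (hL : 0 < L) (hμ : 0 < μ) (hη : 0 < η) (hf : Assumptions L μ γ η f) (hb : 1 ≤ b) (hbn : b ≤ n)
    (hβ : 0 < p.β₁) (hβ' : p.β₁ < 1)
    (hα : ∀ k, p.α k * (√(1 - p.β₂ ^ (k + 1)) / (1 - p.β₁ ^ (k + 1))) = θ k)
    {κ h lo ω R q : ℝ} (hκ : 0 ≤ κ) (hω0 : 0 ≤ ω) (hh : 0 ≤ h)
    (hH : ∀ u : Vec d, ‖diagMul (fun j => 1 / √(v₀ j + p.a)) u‖ ≤ h * ‖u‖)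
    (hHlo : ∀ u : Vec d, lo * ‖u‖ ^ 2 ≤ inner ℝ u (diagMul (fun j => 1 / √(v₀ j + p.a)) u))
    (hR : R = L * h * (p.β₁ / (1 - p.β₁)))
    (hq : q = L * h ^ 2 + (κ + (L + 1 / 2) * (1 + p.β₁ / (1 - p.β₁) * ω * h) ^ 2) * (1 - p.β₁))
    (hκβ : (L + 1 / 2) * (1 + p.β₁ / (1 - p.β₁) * ω * h) ^ 2 * p.β₁ + h ^ 2 * R ^ 2 / 2
      ≤ κ * (1 - p.β₁) / 2)
    {k : ℕ} (hk : k < K₁) (hθ0 : 0 ≤ θ (k + 1)) (hθθ : θ (k + 1) ≤ θ k) (hθ : θ k ≤ 1)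
    (hω : θ k - θ (k + 1) ≤ ω * θ k ^ 2)
    (hθ1 : θ k * (1 + 2 * q * η) ≤ lo / 2)
    (hθ2 : θ k * (2 * q * η * R ^ 2 + κ * (lo * μ)) ≤ κ * (1 - p.β₁) / 2)
    (hclose : ∀ S j, |1 / √(v₀ j + p.a) - 1 / √((run p f x₀ m₀ v₀ K₁ S (k + 1)).v j + p.a)| ≤ θ k)
    {Ω : Type*} [MeasurableSpace Ω] {P : Measure Ω} [IsProbabilityMeasure P]
    {B : ℕ → Ω → Finset (Fin n)} (hB : IsMinibatchSampling P b B) (xstar : Vec d) :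
    ∫ ω, heavyBallPotential (risk f) xstar (diagMul fun j => 1 / √(v₀ j + p.a)) p.β₁ κ (θ (k + 1))
        (run p f x₀ m₀ v₀ K₁ (fun j => B j ω) (k + 1)).x
        (run p f x₀ m₀ v₀ K₁ (fun j => B j ω) (k + 1)).m ∂P
      ≤ (1 - lo * μ * θ k) *
        ∫ ω, heavyBallPotential (risk f) xstar (diagMul fun j => 1 / √(v₀ j + p.a)) p.β₁ κ (θ k)
          (run p f x₀ m₀ v₀ K₁ (fun j => B j ω) k).x
          (run p f x₀ m₀ v₀ K₁ (fun j => B j ω) k).m ∂P + q * γ ^ 2 * θ k ^ 2 := by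
  have hdep : ∀ k, DependsOn (fun S => heavyBallPotential (risk f) xstar
      (diagMul fun j => 1 / √(v₀ j + p.a)) p.β₁ κ (θ k)
      (run p f x₀ m₀ v₀ K₁ S k).x (run p f x₀ m₀ v₀ K₁ S k).m) (Set.Iio k) := fun k =>
    dependsOn_comp_run p f x₀ m₀ v₀ K₁ (fun st => heavyBallPotential (risk f) xstar
      (diagMul fun j => 1 / √(v₀ j + p.a)) p.β₁ κ (θ k) st.x st.m) k
  have hint := hB.integrable (hdep k)
  refine (hB.integral_le_of_batchAvg_le hbn (hdep (k + 1))
    (Φ := fun S => (1 - lo * μ * θ k) * heavyBallPotential (risk f) xstar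
      (diagMul fun j => 1 / √(v₀ j + p.a)) p.β₁ κ (θ k)
      (run p f x₀ m₀ v₀ K₁ S k).x (run p f x₀ m₀ v₀ K₁ S k).m + q * γ ^ 2 * θ k ^ 2)
    (fun x y hxy => by simp only [hdep k hxy]) ?_).trans (le_of_eq ?_)
  · intro S
    have hx : ∀ T, (run p f x₀ m₀ v₀ K₁ (Function.update S k T) (k + 1)).x
        = (run p f x₀ m₀ v₀ K₁ S k).x - θ k • diagMul
          (fun j => 1 / √((run p f x₀ m₀ v₀ K₁ (Function.update S k T) (k + 1)).v j + p.a))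
          (p.β₁ • (run p f x₀ m₀ v₀ K₁ S k).m
            + (1 - p.β₁) • batchGrad f T (run p f x₀ m₀ v₀ K₁ S k).x) := fun T => by
      rw [run_update_succ_of_lt p f x₀ m₀ v₀ K₁ S hk T, adamStep_x, hα]
    have hm : ∀ T, (run p f x₀ m₀ v₀ K₁ (Function.update S k T) (k + 1)).m
        = p.β₁ • (run p f x₀ m₀ v₀ K₁ S k).m
            + (1 - p.β₁) • batchGrad f T (run p f x₀ m₀ v₀ K₁ S k).x := fun T => by
      rw [run_update_succ_of_lt p f x₀ m₀ v₀ K₁ S hk T]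
      rfl
    simp only [hm]
    simp only [hx]
    refine heavyBall_drift hL hμ hη hf hb hbn (H := diagMul fun j => 1 / √(v₀ j + p.a))
      (D := fun T => diagMul (fun j => 1 /
        √((run p f x₀ m₀ v₀ K₁ (Function.update S k T) (k + 1)).v j + p.a)))
      hβ hβ' hκ hθ0 hθθ hθ hω hω0 hh hH hHlo hR hq hκβ hθ1 hθ2 xstar _ _ fun T => ?_
    have hsub : ∀ (h₁ h₂ : Fin d → ℝ) (u : Vec d),
        diagMul h₁ u - diagMul h₂ u = diagMul (fun j => h₁ j - h₂ j) u := fun h₁ h₂ u => by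
      ext j; simp [sub_mul]
    rw [hsub]
    exact norm_diagMul_le (hclose _) (hθ0.trans hθθ) _
  · rw [integral_add (hint.const_mul _) (integrable_const _), integral_const_mul]
    simp

/-- The preconditioner of Adam is nearly constant on a finite horizon if `β₂` is close to `1`. -/
theorem abs_preconditioner_sub_le {R₀ M V t : ℝ} (hf : Assumptions L μ γ η f) (hL : 0 ≤ L)
    (hβ₁ : 0 < p.β₁) (hβ₁' : p.β₁ < 1) (hβ₂ : 0 ≤ p.β₂) (hβ₂' : p.β₂ ≤ 1) (ha : 0 < p.a)
    (hα : ∀ k, p.α k * (√(1 - p.β₂ ^ (k + 1)) / (1 - p.β₁ ^ (k + 1))) = θ k)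
    (hθ : ∀ k, 0 ≤ θ k) (hθ' : ∀ k, θ k ≤ 1) (hR₀ : ∀ T, ‖batchGrad f T x₀‖ ≤ R₀)
    (hM : ‖m₀‖ ≤ M) (hV : 0 ≤ V) (hv₀ : ∀ j, 0 ≤ v₀ j ∧ v₀ j ≤ V)
    (ht : K₁ * ((1 - p.β₂)
      * (((1 + L) * (((1 + 1 / √p.a) * (1 + L) + 1) ^ K₁ * (M + R₀))) ^ 2 + V)) ≤ t * (p.a * √p.a))
    (S : ℕ → Finset (Fin n)) {k : ℕ} (hk : k ≤ K₁) (j : Fin d) :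
    |1 / √(v₀ j + p.a) - 1 / √((run p f x₀ m₀ v₀ K₁ S k).v j + p.a)| ≤ t := by
  have hR0 : 0 ≤ R₀ := (norm_nonneg _).trans (hR₀ ∅)
  have hM0 : 0 ≤ M := (norm_nonneg _).trans hM
  have hbd := fun {k : ℕ} (hk : k ≤ K₁) => adam_run_bounded hf hL hβ₁ hβ₁' hβ₂ hβ₂' ha hα hθ hθ' hR₀
    hM (fun j => (hv₀ j).1) S hk
  have hsa : 0 < √p.a := Real.sqrt_pos.2 ha
  set Q := (1 + 1 / √p.a) * (1 + L) + 1
  have hQ : 1 ≤ Q := by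
    have : 0 ≤ (1 + 1 / √p.a) * (1 + L) := by positivity
    linarith
  have hG : ∀ k < K₁, ‖batchGrad f (S k) (run p f x₀ m₀ v₀ K₁ S k).x‖
      ≤ (1 + L) * (Q ^ K₁ * (M + R₀)) := fun k hk => by
    have h1 := (hbd hk.le).2
    have h2 := norm_batchGrad_run_le hf hL hR₀ (S k) (run p f x₀ m₀ v₀ K₁ S k).x
    have h3 : Q ^ k * (M + R₀) ≤ Q ^ K₁ * (M + R₀) := by
      gcongr
    have h4 := norm_nonneg (run p f x₀ m₀ v₀ K₁ S k).m
    have h5 := norm_nonneg ((run p f x₀ m₀ v₀ K₁ S k).x - x₀)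
    have h6 := mul_le_mul_of_nonneg_left (h1.trans h3) hL
    have h7 := mul_nonneg hL h4
    have h8 := mul_nonneg hL hR0
    linarith
  have hv := abs_adam_v_sub_le hβ₂ hβ₂' hv₀ S hG hk j
  have h1 := abs_inv_sqrt_sub_le ha (s := v₀ j + p.a)
    (t := (run p f x₀ m₀ v₀ K₁ S k).v j + p.a) (by linarith [(hv₀ j).1])
    (by linarith [(hbd hk).1 j])
  refine h1.trans ?_
  rw [div_le_iff₀ (by positivity), add_sub_add_right_eq_sub, abs_sub_comm]
  refine hv.trans (le_trans ?_ ht)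
  have : 0 ≤ 1 - p.β₂ := by linarith
  gcongr

end AdamPhase

set_option maxHeartbeats 1000000 in
/-- Adam with suitable step sizes reaches accuracy `ζ` within `O(1/ζ)` iterations. -/
theorem exists_adam_complexity {L μ γ η Δ M V a β₁ : ℝ}
    (hL : 0 < L) (hμ : 0 < μ) (hη : 0 < η) (hΔ : 0 ≤ Δ) (hV : 0 ≤ V)
    (ha : 0 < a) (hβ₁ : 0 < β₁) (hβ₁' : β₁ < 1) :
    ∃ C : ℝ, 0 < C ∧ ∀ (n : ℕ) (ζ : ℝ), 0 < ζ → ζ ≤ 1 →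
    ∃ βlow : ℝ, 0 < βlow ∧ βlow < 1 ∧ ∀ β₂ : ℝ, βlow ≤ β₂ → β₂ < 1 →
    ∃ α : ℕ → ℝ, (∀ k, 0 < α k) ∧
    ∀ d b : ℕ, 1 ≤ b → b ≤ n → ∀ f : Fin n → Vec d → ℝ, Assumptions L μ γ η f →
    ∀ xstar : Vec d, (∀ x, risk f xstar ≤ risk f x) →
    ∀ x₀ m₀ v₀ : Vec d, risk f x₀ - risk f xstar ≤ Δ →
      ‖m₀‖ ≤ M → (∀ j, 0 ≤ v₀ j ∧ v₀ j ≤ V) → ∀ (mem : ℕ) (τ : ℝ),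
    ∀ (Ω : Type*) (_ : MeasurableSpace Ω) (P : Measure Ω) (_ : IsProbabilityMeasure P)
      (B : ℕ → Ω → Finset (Fin n)), IsMinibatchSampling P b B →
    ∃ K : ℕ, (K : ℝ) ≤ C * (1 / ζ) ∧
      ∫ ω, ‖gradient (risk f) (iterate ⟨β₁, β₂, a, α, mem, τ⟩ f x₀ m₀ v₀ K
        (fun j => B j ω) K)‖ ^ 2 ∂P ≤ ζ := by
  have h1β : 0 < 1 - β₁ := by linarith
  have hsa : 0 < √a := Real.sqrt_pos.2 ha
  set ρ := β₁ / (1 - β₁) with hρ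
  have hρ0 : 0 < ρ := by positivity
  set h := 1 / √a with hh
  set lo := 1 / √(V + a) with hlo
  have hh0 : 0 < h := by positivity
  have hlo0 : 0 < lo := by positivity
  set l := lo * μ with hl
  have hl0 : 0 < l := by positivity
  -- Makes the contraction factor 1 - 2/(k + k₀), as the 1/k rate needs.
  set A := 2 / l with hA
  have hA0 : 0 < A := by positivity
  have hlA : l * A = 2 := by rw [hA]; field_simp
  set ω₀ := 1 / A with hω₀
  have hω0 : 0 < ω₀ := by positivity
  set R := L * h * ρ with hR
  have hR0 : 0 < R := by positivity
  set D := (L + 1 / 2) * (1 + ρ * ω₀ * h) ^ 2 with hD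
  have hD0 : 0 < D := by positivity
  obtain ⟨κ, hκ0, hκ⟩ : ∃ κ : ℝ, 0 < κ ∧ D * β₁ + h ^ 2 * R ^ 2 / 2 ≤ κ * (1 - β₁) / 2 := by
    refine ⟨2 * (D * β₁ + h ^ 2 * R ^ 2 / 2) / (1 - β₁), by positivity, le_of_eq ?_⟩
    field_simp
  set q := L * h ^ 2 + (κ + D) * (1 - β₁) with hq
  have hq0 : 0 < q := by positivity
  obtain ⟨θm, hθm0, hθm1, hθm2, hθm3⟩ : ∃ t : ℝ, 0 < t ∧ t ≤ 1 ∧ t * (1 + 2 * q * η) ≤ lo / 2 ∧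
      t * (2 * q * η * R ^ 2 + κ * l) ≤ κ * (1 - β₁) / 2 := by
    refine ⟨min 1 (min (lo / 2 / (1 + 2 * q * η)) (κ * (1 - β₁) / 2 / (2 * q * η * R ^ 2 + κ * l))),
      by positivity, min_le_left _ _, ?_, ?_⟩
    · rw [← le_div_iff₀ (by positivity)]
      exact (min_le_right _ _).trans (min_le_left _ _)
    · rw [← le_div_iff₀ (by positivity)]
      exact (min_le_right _ _).trans (min_le_right _ _)
  -- The offset keeps even the first step below the cap `θm`.
  obtain ⟨k₀, hk₀2, hk₀⟩ : ∃ k₀ : ℝ, 2 ≤ k₀ ∧ A / k₀ ≤ θm := by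
    refine ⟨max 2 (A / θm), le_max_left _ _, ?_⟩
    rw [div_le_comm₀ (by positivity) hθm0]
    exact le_max_right _ _
  have hk₀0 : 0 < k₀ := by linarith
  set θ : ℕ → ℝ := fun k => A / (k + k₀) with hθ
  have hθ0 : ∀ k, 0 < θ k := fun k => by simp only [hθ]; positivity
  have hθm : ∀ k, θ k ≤ θm := fun k => by
    refine le_trans ?_ hk₀
    simp only [hθ]
    gcongr
    have : (0 : ℝ) ≤ k := Nat.cast_nonneg k
    linarith
  have hθanti : ∀ {i j : ℕ}, i ≤ j → θ j ≤ θ i := fun {i j} hij => by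
    simp only [hθ]
    gcongr
  have hθω : ∀ k, θ k - θ (k + 1) ≤ ω₀ * θ k ^ 2 := fun k => by
    have hs : 0 < (k : ℝ) + k₀ := by positivity
    simp only [hθ, hω₀]
    push_cast
    rw [show A / ((k : ℝ) + k₀) - A / (k + 1 + k₀) = A / ((k + k₀) * (k + 1 + k₀)) by
      field_simp; ring, show 1 / A * (A / ((k : ℝ) + k₀)) ^ 2 = A / ((k + k₀) * (k + k₀)) by
      field_simp]
    gcongr
    linarith
  set W₀ := Δ + L * Δ + (1 / 2 + L / 2) * (ρ * h * M) ^ 2 + κ * M ^ 2 with hW₀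
  have hW₀0 : 0 ≤ W₀ := by positivity
  set Q := max (k₀ * W₀) (q * γ ^ 2 * A ^ 2) with hQ
  have hQ0 : 0 ≤ Q := le_max_of_le_left (by positivity)
  set C₂ := 4 * L + 2 * R ^ 2 / κ with hC₂
  have hC₂0 : 0 < C₂ := by positivity
  refine ⟨C₂ * Q + 1, by positivity, ?_⟩
  intro n ζ hζ hζ1
  -- The horizon is fixed before β₂, at the time when C₂·Q/(K + k₀) has fallen below ζ.
  set K := ⌈C₂ * Q / ζ⌉₊ with hK
  set R₀ := √(n * (γ ^ 2 + η * (2 * L * Δ))) with hR₀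
  set G := ((1 + L) * (((1 + 1 / √a) * (1 + L) + 1) ^ K * (M + R₀))) ^ 2 + V with hG
  have hG0 : 0 ≤ G := by positivity
  -- ξ bounds 1 - β₂: the total drift of the second moments over K steps must keep the
  -- preconditioner error below θ_K, the smallest step up to the horizon.
  obtain ⟨ξ, hξ0, hξ1, hξ⟩ : ∃ ξ : ℝ, 0 < ξ ∧ ξ < 1 ∧ K * (ξ * G) ≤ θ K * (a * √a) := by
    have hden : 0 < (K + 1) * (G + 1) := by positivity
    have hnum : 0 < θ K * (a * √a) := mul_pos (hθ0 K) (by positivity)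
    refine ⟨min (1 / 2) (θ K * (a * √a) / ((K + 1) * (G + 1))), by positivity,
      (min_le_left _ _).trans_lt (by norm_num), ?_⟩
    have h1 := min_le_right (1 / 2) (θ K * (a * √a) / ((K + 1) * (G + 1)))
    set ξ := min (1 / 2) (θ K * (a * √a) / ((K + 1) * (G + 1)))
    have hξ0 : 0 ≤ ξ := by positivity
    rw [le_div_iff₀ hden] at h1
    refine le_trans ?_ h1
    have hK0 : (0 : ℝ) ≤ K := Nat.cast_nonneg K
    calc K * (ξ * G) = ξ * (K * G) := by ring
      _ ≤ ξ * ((K + 1) * (G + 1)) := by gcongr <;> linarith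
  refine ⟨1 - ξ, by linarith, by linarith, ?_⟩
  intro β₂ hβ₂ hβ₂'
  have hβ₂0 : 0 < β₂ := by linarith
  have hpow₁ : ∀ k : ℕ, 0 < 1 - β₁ ^ (k + 1) := fun k =>
    sub_pos.2 (pow_lt_one₀ hβ₁.le hβ₁' k.succ_ne_zero)
  have hpow₂ : ∀ k : ℕ, 0 < √(1 - β₂ ^ (k + 1)) := fun k =>
    Real.sqrt_pos.2 (sub_pos.2 (pow_lt_one₀ hβ₂0.le hβ₂' k.succ_ne_zero))
  refine ⟨fun k => θ k * ((1 - β₁ ^ (k + 1)) / √(1 - β₂ ^ (k + 1))),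
    fun k => mul_pos (hθ0 k) (div_pos (hpow₁ k) (hpow₂ k)), ?_⟩
  intro d b hb hbn f hf xstar hmin x₀ m₀ v₀ hx₀ hm₀ hv₀ mem τ Ω _ P _ B hB
  set p : Params := ⟨β₁, β₂, a, fun k => θ k * ((1 - β₁ ^ (k + 1)) / √(1 - β₂ ^ (k + 1))), mem, τ⟩
    with hp
  have hF := hf.smoothStronglyConvex (hb.trans hbn)
  have hα : ∀ k, p.α k * (√(1 - p.β₂ ^ (k + 1)) / (1 - p.β₁ ^ (k + 1))) = θ k := fun k => by
    have h1 := (hpow₁ k).ne'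
    have h2 := (hpow₂ k).ne'
    simp only [hp]
    field_simp
  have hR₀' := norm_batchGrad_le_sqrt hf hL hη (hb.trans hbn) hmin hx₀
  have hclose : ∀ k < K, ∀ S j,
      |1 / √(v₀ j + p.a) - 1 / √((run p f x₀ m₀ v₀ K S (k + 1)).v j + p.a)| ≤ θ k := by
    intro k hk S j
    refine abs_preconditioner_sub_le hf hL.le hβ₁ hβ₁' hβ₂0.le hβ₂'.le ha hα
      (fun k => (hθ0 k).le) (fun k => (hθm k).trans hθm1) hR₀' hm₀ hV hv₀ ?_ S hk j
    have h1 : K * ((1 - β₂) * G) ≤ K * (ξ * G) := by gcongr; linarith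
    refine h1.trans (hξ.trans ?_)
    exact mul_le_mul_of_nonneg_right (hθanti hk.le) (by positivity)
  have hH : ∀ u : Vec d, ‖diagMul (fun j => 1 / √(v₀ j + p.a)) u‖ ≤ h * ‖u‖ := by
    refine norm_diagMul_le (fun j => ?_) hh0.le
    rw [abs_of_nonneg (by positivity), hh]
    have := Real.sqrt_le_sqrt (show a ≤ v₀ j + a by linarith [(hv₀ j).1])
    simp only [hp]
    gcongr
  have hHlo : ∀ u : Vec d, lo * ‖u‖ ^ 2 ≤ inner ℝ u (diagMul (fun j => 1 / √(v₀ j + p.a)) u) := by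
    refine le_inner_diagMul fun j => ?_
    have h1 := Real.sqrt_le_sqrt (show v₀ j + a ≤ V + a by linarith [(hv₀ j).2])
    have h2 : 0 < √(v₀ j + a) := Real.sqrt_pos.2 (by linarith [(hv₀ j).1])
    simp only [hp, hlo]
    gcongr
  set H : Vec d →ₗ[ℝ] Vec d := diagMul fun j => 1 / √(v₀ j + p.a) with hHdef
  have hdecay := le_div_of_contraction (u := fun k => ∫ ω, heavyBallPotential (risk f) xstar H β₁ κ
      (θ k) (run p f x₀ m₀ v₀ K (fun j => B j ω) k).x
      (run p f x₀ m₀ v₀ K (fun j => B j ω) k).m ∂P) (K := K) (e := q * γ ^ 2) (Q := Q)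
    hk₀0 hlA ?_ (le_max_right _ _) hQ0 hk₀2 ?_ le_rfl
  · refine ⟨K, ?_, ?_⟩
    · have h1 := (Nat.ceil_lt_add_one (show 0 ≤ C₂ * Q / ζ by positivity)).le
      have h2 : 1 ≤ 1 / ζ := (one_le_div₀ hζ).2 hζ1
      refine h1.trans ?_
      have e : (C₂ * Q + 1) * (1 / ζ) = C₂ * Q / ζ + 1 / ζ := by ring
      linarith
    · have hdep := dependsOn_comp_run p f x₀ m₀ v₀ K
        (fun st => ‖gradient (risk f) st.x‖ ^ 2) K
      have hdep' := dependsOn_comp_run p f x₀ m₀ v₀ K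
        (fun st => C₂ * heavyBallPotential (risk f) xstar H β₁ κ (θ K) st.x st.m) K
      have h1 := integral_mono (hB.integrable hdep) (hB.integrable hdep') fun ω =>
        hF.norm_gradient_sq_le_heavyBallPotential hL hmin hβ₁ hβ₁' hκ0 (hθ0 K).le hh0.le hH _ _
      refine h1.trans ?_
      rw [integral_const_mul]
      refine (mul_le_mul_of_nonneg_left hdecay hC₂0.le).trans ?_
      have h2 : C₂ * Q / ζ ≤ K := Nat.le_ceil _
      rw [div_le_iff₀ hζ] at h2
      rw [← mul_div_assoc, div_le_iff₀ (by positivity)]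
      have h3 := mul_pos hζ hk₀0
      linarith
  · have h1 := hF.heavyBallPotential_initial_le hL hmin (κ := κ) (θ := θ 0) hβ₁ hβ₁' hκ0.le
      (hθ0 0).le ((hθm 0).trans hθm1) hh0.le hH hx₀ hm₀
    have h2 : W₀ ≤ Q / k₀ := by
      rw [le_div_iff₀' hk₀0]
      exact le_max_left _ _
    simp only [run, integral_const, probReal_univ, one_smul]
    exact h1.trans h2
  · intro k hk
    exact integral_heavyBallPotential_run_succ_le hL hμ hη hf hb hbn hβ₁ hβ₁' hα hκ0.le hω0.le
      hh0.le hH hHlo hR hq hκ hk (hθ0 _).le (hθanti k.le_succ) ((hθm k).trans hθm1) (hθω k)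
      ((mul_le_mul_of_nonneg_right (hθm k) (by positivity)).trans hθm2)
      ((mul_le_mul_of_nonneg_right (hθm k) (by positivity)).trans hθm3) (hclose k hk) hB xstar

end FusePV

end

/-! ### Joining the two phases -/

theorem theorem1
    (L μ γ η Δ M V a β₁ ζmax : ℝ) (mem : ℕ)
    (hL : 0 < L) (hμ : 0 < μ) (hγ : 0 ≤ γ) (hη : 0 < η) (hΔ : 0 ≤ Δ) (hM : 0 ≤ M) (hV : 0 ≤ V)
    (ha : 0 < a) (hβ₁ : 0 < β₁) (hβ₁' : β₁ < 1) (hζmax : 0 < ζmax) (hζmax' : ζmax < 1)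
    (hmem : 1 ≤ mem) :
    -- constants depending only on the numbers above: the range of the L-BFGS step size `τ`,
    -- the linear rate, and the size of the neighbourhood
    ∃ τ₀ c N : ℝ, 0 < τ₀ ∧ 0 < c ∧ c * τ₀ < 1 ∧ 0 < N ∧
    ∀ τ : ℝ, 0 < τ → τ ≤ τ₀ →
    -- the complexity constant
    ∃ C : ℝ, 0 < C ∧
    ∀ d n b : ℕ, 1 ≤ b → b ≤ n →
    ∀ ζ : ℝ, 0 < ζ → ζ ≤ ζmax →
    -- the choice of the Adam parameters
    ∃ βlow : ℝ, 0 < βlow ∧ βlow < 1 ∧ ∀ β₂ : ℝ, βlow ≤ β₂ → β₂ < 1 →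
    ∃ α : ℕ → ℝ, (∀ k, 0 < α k) ∧
    ∀ f : Fin n → FusePV.Vec d → ℝ, FusePV.Assumptions L μ γ η f →
    ∀ xstar : FusePV.Vec d, (∀ x, FusePV.risk f xstar ≤ FusePV.risk f x) →
    ∀ x₀ m₀ v₀ : FusePV.Vec d, FusePV.risk f x₀ - FusePV.risk f xstar ≤ Δ →
      ‖m₀‖ ≤ M → (∀ j, 0 ≤ v₀ j ∧ v₀ j ≤ V) →
    ∀ (Ω : Type*) (_ : MeasurableSpace Ω) (P : Measure Ω) (_ : IsProbabilityMeasure P)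
      (B : ℕ → Ω → Finset (Fin n)), FusePV.IsMinibatchSampling P b B →
    -- `X K₁ k ω` is the `k`-th iterate when the switchover takes place at iteration `K₁`
    let X : ℕ → ℕ → Ω → FusePV.Vec d := fun K₁ k ω =>
      FusePV.iterate ⟨β₁, β₂, a, α, mem, τ⟩ f x₀ m₀ v₀ K₁ (fun j => B j ω) k
    ∃ K₁ : ℕ,
      -- the switchover takes place at the first iteration of accuracy `ζ`, and that is `O(1/ζ)`
      IsLeast {k : ℕ | ∫ ω, ‖gradient (FusePV.risk f) (X K₁ k ω)‖ ^ 2 ∂P ≤ ζ} K₁ ∧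
      (K₁ : ℝ) ≤ C * (1 / ζ) ∧
      -- linear convergence of the L-BFGS phase to a neighbourhood
      (∀ k : ℕ, ∫ ω, (FusePV.risk f (X K₁ (K₁ + k) ω) - FusePV.risk f xstar) ∂P
        ≤ (1 - c * τ) ^ k * ∫ ω, (FusePV.risk f (X K₁ K₁ ω) - FusePV.risk f xstar) ∂P
          + N * τ * γ ^ 2) ∧
      (∀ k : ℕ, ∫ ω, ‖X K₁ (K₁ + k) ω - xstar‖ ^ 2 ∂P
        ≤ N * (1 - c * τ) ^ k * ∫ ω, ‖X K₁ K₁ ω - xstar‖ ^ 2 ∂P + N * τ * γ ^ 2) ∧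
      -- accuracy `ε` (up to the neighbourhood) after `O(log(1/ε))` iterations of L-BFGS
      ∀ ε : ℝ, 0 < ε → ε < ζ → ∃ K₂ : ℕ,
        (K₂ : ℝ) ≤ C * Real.log (1 / ε) ∧
        ((K₁ + K₂ : ℕ) : ℝ) ≤ C * max (1 / ζ) (Real.log (1 / ε)) ∧
        ∀ k : ℕ, K₁ + K₂ ≤ k →
          ∫ ω, ‖gradient (FusePV.risk f) (X K₁ k ω)‖ ^ 2 ∂P ≤ ε + N * τ * γ ^ 2 := by
  obtain ⟨τ₀, c, N₀, hτ₀, hc, hcτ₀, hN₀, hrate⟩ := FusePV.exists_lbfgs_rate hL hμ hη mem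
  obtain ⟨CA, hCA, hadam⟩ := FusePV.exists_adam_complexity (γ := γ) hL hμ hη hΔ hV
    (M := M) ha hβ₁ hβ₁'
  refine ⟨τ₀, c, N₀ + L / μ + 2 / μ * N₀ + 2 * L * N₀, hτ₀, hc, hcτ₀, by positivity, ?_⟩
  intro τ hτ hττ₀
  set ℓ := Real.log (1 / ζmax) with hℓ
  have hℓ0 : 0 < ℓ := Real.log_pos ((one_lt_div hζmax).2 hζmax')
  -- Since log(1/ε) ≥ ℓ > 0, additive constants, including the rounding in K₂, become multiples of
  -- log(1/ε); this is why ζ is bounded away from 1.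
  set C₀ := 1 / (c * τ) + (L / μ / (c * τ) + 1) / ℓ with hC₀
  have hC₀0 : 0 < C₀ := by positivity
  refine ⟨CA + C₀, by positivity, ?_⟩
  intro d n b hb hbn ζ hζ hζm
  obtain ⟨βlow, hβ0, hβ1, hβ⟩ := hadam n ζ hζ (hζm.trans hζmax'.le)
  refine ⟨βlow, hβ0, hβ1, fun β₂ hβ₂ hβ₂' => ?_⟩
  obtain ⟨α, hα0, hα⟩ := hβ β₂ hβ₂ hβ₂'
  refine ⟨α, hα0, ?_⟩
  intro f hf xstar hmin x₀ m₀ v₀ hx₀ hm₀ hv₀ Ω _ P _ B hB X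
  have hF := hf.smoothStronglyConvex (hb.trans hbn)
  obtain ⟨K, hKC, hK⟩ := hα d b hb hbn f hf xstar hmin x₀ m₀ v₀ hx₀ hm₀ hv₀ mem τ Ω _ P inferInstance B hB
  have hXeq : ∀ {K K' k : ℕ}, k ≤ K → k ≤ K' → X K k = X K' k := fun h h' => by
    funext ω
    exact congrArg FusePV.State.x (FusePV.run_eq_of_le _ f x₀ m₀ v₀ h h' fun j => B j ω)
  have hint : ∀ (φ : FusePV.Vec d → ℝ) (K k : ℕ), Integrable (fun ω => φ (X K k ω)) P :=
    fun φ K k => hB.integrable (FusePV.dependsOn_comp_run ⟨β₁, β₂, a, α, mem, τ⟩ f x₀ m₀ v₀ K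
      (fun st => φ st.x) k)
  have hex : ∃ k, ∫ ω, ‖gradient (FusePV.risk f) (X k k ω)‖ ^ 2 ∂P ≤ ζ := ⟨K, hK⟩
  classical
  set K₁ := Nat.find hex with hK₁
  have hK₁ζ : ∫ ω, ‖gradient (FusePV.risk f) (X K₁ K₁ ω)‖ ^ 2 ∂P ≤ ζ := Nat.find_spec hex
  have hK₁C : (K₁ : ℝ) ≤ CA * (1 / ζ) := le_trans (by exact_mod_cast Nat.find_min' hex hK) hKC
  have hζ1 : 0 < 1 / ζ := by positivity
  have hlin := hrate ⟨β₁, β₂, a, α, mem, τ⟩ rfl hτ hττ₀ γ d n b hb hbn f hf xstar x₀ m₀ v₀ Ω _ P inferInstance B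
    hB K₁
  replace hlin : ∀ k, ∫ ω, (FusePV.risk f (X K₁ (K₁ + k) ω) - FusePV.risk f xstar) ∂P
      ≤ (1 - c * τ) ^ k * ∫ ω, (FusePV.risk f (X K₁ K₁ ω) - FusePV.risk f xstar) ∂P
        + N₀ * τ * γ ^ 2 := hlin
  have hcτ : c * τ < 1 := (mul_le_mul_of_nonneg_left hττ₀ hc.le).trans_lt hcτ₀
  have hcτ0 : 0 < c * τ := by positivity
  have hr0 : 0 ≤ 1 - c * τ := by linarith
  have hτγ : 0 ≤ τ * γ ^ 2 := by positivity
  have hLμ : 0 < L / μ := by positivity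
  have h2μ : 0 < 2 / μ * N₀ := by positivity
  have h2L : 0 < 2 * L * N₀ := by positivity
  refine ⟨K₁, ⟨hK₁ζ, fun k hk => ?_⟩, ?_, fun k => ?_, fun k => ?_, ?_⟩
  · rcases le_or_gt K₁ k with h | h
    · exact h
    · refine absurd ?_ (Nat.find_min hex h)
      rw [hXeq le_rfl h.le]
      exact hk
  · refine hK₁C.trans ?_
    gcongr
    linarith
  · refine (hlin k).trans ?_
    rw [mul_assoc N₀, mul_assoc _ τ]
    gcongr
    linarith
  · have h1 : ∫ ω, ‖X K₁ (K₁ + k) ω - xstar‖ ^ 2 ∂P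
        ≤ 2 / μ * ∫ ω, (FusePV.risk f (X K₁ (K₁ + k) ω) - FusePV.risk f xstar) ∂P := by
      rw [← integral_const_mul]
      refine integral_mono (hint (fun x => ‖x - xstar‖ ^ 2) _ _)
        (hint (fun x => 2 / μ * (FusePV.risk f x - FusePV.risk f xstar)) _ _) fun ω => ?_
      have h := hF.norm_sq_le_sub hL hmin (X K₁ (K₁ + k) ω)
      simp only
      rw [div_mul_eq_mul_div, le_div_iff₀ hμ]
      linarith
    have h2 : ∫ ω, (FusePV.risk f (X K₁ K₁ ω) - FusePV.risk f xstar) ∂P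
        ≤ L / 2 * ∫ ω, ‖X K₁ K₁ ω - xstar‖ ^ 2 ∂P := by
      rw [← integral_const_mul]
      exact integral_mono (hint (fun x => FusePV.risk f x - FusePV.risk f xstar) _ _)
        (hint (fun x => L / 2 * ‖x - xstar‖ ^ 2) _ _) fun ω => hF.sub_le_norm_sq hL hmin _
    have h3 := pow_nonneg hr0 k
    have h4 : 0 ≤ ∫ ω, ‖X K₁ K₁ ω - xstar‖ ^ 2 ∂P := integral_nonneg fun ω => sq_nonneg _
    set I := ∫ ω, ‖X K₁ K₁ ω - xstar‖ ^ 2 ∂P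
    calc _ ≤ 2 / μ * ((1 - c * τ) ^ k * (L / 2 * I) + N₀ * τ * γ ^ 2) := by
          refine h1.trans ?_
          have := hlin k
          gcongr
          refine this.trans ?_
          gcongr
      _ = L / μ * ((1 - c * τ) ^ k * I) + 2 / μ * N₀ * (τ * γ ^ 2) := by field_simp
      _ ≤ (N₀ + L / μ + 2 / μ * N₀ + 2 * L * N₀) * ((1 - c * τ) ^ k * I)
          + (N₀ + L / μ + 2 / μ * N₀ + 2 * L * N₀) * (τ * γ ^ 2) := by
          gcongr <;> linarith
      _ = _ := by ring
  · intro ε hε hεζ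
    have hlog : ℓ ≤ Real.log (1 / ε) :=
      Real.log_le_log (by positivity) (one_div_le_one_div_of_le hε (hεζ.le.trans hζm))
    set Λ := Real.log (1 / ε) with hΛ
    have hΛ0 : 0 < Λ := hℓ0.trans_le hlog
    have hK₂ : (⌈(L / μ + Λ) / (c * τ)⌉₊ : ℝ) ≤ C₀ * Λ := by
      refine (Nat.ceil_lt_add_one (by positivity)).le.trans ?_
      have h1 : L / μ / (c * τ) + 1 ≤ (L / μ / (c * τ) + 1) / ℓ * Λ := by
        rw [div_mul_eq_mul_div, le_div_iff₀ hℓ0]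
        gcongr
      have e : C₀ * Λ = Λ / (c * τ) + (L / μ / (c * τ) + 1) / ℓ * Λ := by rw [hC₀]; ring
      rw [e, add_div]
      linarith
    refine ⟨⌈(L / μ + Λ) / (c * τ)⌉₊, hK₂.trans (by gcongr; linarith), ?_, ?_⟩
    · push_cast
      refine (add_le_add hK₁C hK₂).trans ?_
      rw [add_mul CA]
      exact add_le_add (mul_le_mul_of_nonneg_left (le_max_left _ _) hCA.le)
        (mul_le_mul_of_nonneg_left (le_max_right _ _) hC₀0.le)
    · intro k hk
      obtain ⟨j, rfl⟩ : ∃ j, k = K₁ + j := ⟨k - K₁, by omega⟩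
      have hj : (L / μ + Λ) / (c * τ) ≤ j :=
        (Nat.le_ceil _).trans (by exact_mod_cast (by omega : ⌈(L / μ + Λ) / (c * τ)⌉₊ ≤ j))
      rw [div_le_iff₀ hcτ0] at hj
      -- The term L/μ in K₂ absorbs the condition number, because t·exp(-t) ≤ 1.
      have hpow : L / μ * (1 - c * τ) ^ j ≤ ε := by
        have h1 : (1 - c * τ) ^ j ≤ Real.exp (-(L / μ + Λ)) := by
          calc (1 - c * τ) ^ j ≤ Real.exp (-(c * τ)) ^ j := by
                gcongr
                exact Real.one_sub_le_exp_neg _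
            _ = Real.exp (-(j * (c * τ))) := by rw [← Real.exp_nat_mul]; ring_nf
            _ ≤ _ := by gcongr
        have h2 : Real.exp (-(L / μ + Λ)) = Real.exp (-(L / μ)) * ε := by
          rw [neg_add, Real.exp_add, hΛ, one_div, Real.log_inv, neg_neg, Real.exp_log hε]
        have h3 : L / μ * Real.exp (-(L / μ)) ≤ 1 := by
          rw [Real.exp_neg, mul_inv_le_iff₀ (Real.exp_pos _), one_mul]
          linarith [Real.add_one_le_exp (L / μ)]
        calc L / μ * (1 - c * τ) ^ j ≤ L / μ * (Real.exp (-(L / μ)) * ε) := by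
              rw [← h2]; gcongr
          _ = (L / μ * Real.exp (-(L / μ))) * ε := by ring
          _ ≤ 1 * ε := by gcongr
          _ = ε := one_mul _
      have h1 : ∫ ω, ‖gradient (FusePV.risk f) (X K₁ (K₁ + j) ω)‖ ^ 2 ∂P
          ≤ 2 * L * ∫ ω, (FusePV.risk f (X K₁ (K₁ + j) ω) - FusePV.risk f xstar) ∂P := by
        rw [← integral_const_mul]
        exact integral_mono (hint (fun x => ‖gradient (FusePV.risk f) x‖ ^ 2) _ _)
          (hint (fun x => 2 * L * (FusePV.risk f x - FusePV.risk f xstar)) _ _)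
          fun ω => hF.norm_gradient_sq_le hL hmin _
      have h2 : 2 * μ * ∫ ω, (FusePV.risk f (X K₁ K₁ ω) - FusePV.risk f xstar) ∂P ≤ 1 := by
        rw [← integral_const_mul]
        refine (integral_mono (hint (fun x => 2 * μ * (FusePV.risk f x - FusePV.risk f xstar)) _ _)
          (hint (fun x => ‖gradient (FusePV.risk f) x‖ ^ 2) _ _)
          fun ω => hF.polyak_lojasiewicz hμ _ xstar).trans ?_
        exact hK₁ζ.trans (hζm.trans hζmax'.le)
      set I := ∫ ω, (FusePV.risk f (X K₁ K₁ ω) - FusePV.risk f xstar) ∂P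
      have h3 : I ≤ 1 / (2 * μ) := by rwa [le_div_iff₀' (by positivity)]
      calc _ ≤ 2 * L * ((1 - c * τ) ^ j * (1 / (2 * μ)) + N₀ * τ * γ ^ 2) := by
            refine h1.trans ?_
            have := hlin j
            gcongr
            refine this.trans ?_
            gcongr
        _ = L / μ * (1 - c * τ) ^ j + 2 * L * N₀ * (τ * γ ^ 2) := by field_simp
        _ ≤ ε + (N₀ + L / μ + 2 / μ * N₀ + 2 * L * N₀) * (τ * γ ^ 2) := by
            gcongr
            linarith
        _ = _ := by ring
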